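/- Let $\mathbb F$ be a finite field with $q$ elements, $(m)_q=1+q+\cdots+q^{m-1}$, let $B_q(n)$ be the set of all subspaces of $\mathbb F^n$, $\binom{n}{k}_q$ the number of those of dimension $k$, $G_q(n)=\sum_{k=0}^n\binom nk_q$ the Galois number, and $\mathbb C[B_q(n)]$ the complex vector space with basis $B_q(n)$. Let $M_q(n)$ be the $B_q(n)\times B_q(n)$ matrix with $M_q(n)(X,Y)=1$ if $Y\subseteq X$ and $\dim Y=\dim X-1$, $M_q(n)(X,Y)=q^{\dim X}$ if $X\subseteq Y$ and $\dim Y=\dim X+1$, and $0$ otherwise. Let $\langle u,v\rangle_\pi=\sum_{X\in B_q(n)}\overline{u(X)}\,v(X)\,\pi(X)$, where $\pi(X)=q^{\binom{\dim X}{2}}/\prod_{i=0}^{n-1}(1+q^i)$. Notation. Identify $\mathbb F^n$ with the hyperplane of $\mathbb F^{n+1}$ of vectors with last component $0$; so $B_q(n)\subseteq B_q(n+1)$. Let $A_q(n+1)=B_q(n+1)\setminus B_q(n)$, and for $X\in B_q(n)$ let $\widehat X=\mathrm{span}(X,e_{n+1})$ and $\theta_n(X)=\sum Y$, the sum over the $Y\in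 A_q(n+1)$ covering $X$ (extended linearly). Let $H(n+1,\mathbb F)\le GL(n+1,\mathbb F)$ be the group of matrices $\begin{pmatrix}I&a\\0&1\end{pmatrix}$, $a\in\mathbb F^n$, acting on $\mathbb C[B_q(n+1)]$, and $\mathcal N_q(n)$ the set of its nontrivial irreducible (degree one) characters. For a character $\chi$ let $W(\chi)$ be the $\chi$-isotypic component of $\mathbb C[A_q(n+1)]$, with $W(0)$ for the trivial character, and $p(\chi)=\sum_{g}\overline{\chi(g)}\,g$. Index set. $\mathcal E_q(0)=\{()\}$, $\mathcal E_q(1)=\{(0),(1)\}$, and for $n\ge2$ the set $\mathcal E_q(n)$ consists of the sequences $(\beta,0)$, $(\beta,1)$ with $\beta\in\mathcal E_q(n-1)$ and $(\beta,\chi)$ with $\beta\in\mathcal E_q(n-2)$, $\chi\in\mathcal N_q(n-1)$. $N(\alpha)$ is the number of nonzero entries of $\alpha$ (characters count as nonzero). Vectors. Define $v_\alpha\in\mathbb C[B_q(n)]$, $\alpha\in\mathcal E_q(n)$, inductively by $v_{()}=\{0\}$ and - $v_{(\beta,0)}=q^{N(\beta)}v_\beta+\theta_n(v_\beta)$ and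 $v_{(\beta,1)}=q^{n-N(\beta)}v_\beta-\theta_n(v_\beta)$ for $\beta\in\mathcal E_q(n)$; - for $\beta\in\mathcal E_q(n)$, $\chi\in\mathcal N_q(n+1)$: $v_{(\beta,\chi)}=\lambda(\chi)\,\mu(X)\,v_\beta$. Here $X=X(\chi)$ is the hyperplane of $\mathbb F^{n+1}$ with $p(\chi)(\widehat X)\ne0$; $\mu(X):\mathbb C[B_q(n)]\to\mathbb C[B_q(X)]$ is induced by the map $\mathbb F^n\to X$ sending $e_j$ to the $j$-th column of the $(n+1)\times n$ matrix in Schubert normal form (column reduced echelon form) with column space $X$; and $\lambda(\chi)(Y)=q^{-\dim Y}p(\chi)(\widehat Y)$ for $Y\in B_q(X)$, extended linearly. Theorem. For every finite field $\mathbb F$ and every $n\ge 0$: (1) $N(\alpha)\le n$ for all $\alpha\in\mathcal E_q(n)$, $|\mathcal E_q(n)|=G_q(n)$, and $|\{\alpha\in\mathcal E_q(n):N(\alpha)=k\}|=\binom nk_q$ for all $k$. (2) The construction involves no choices: for every $\chi\in\mathcal N_q(n)$ there is exactly one $X\in B_q(n)$ of dimension $n-1$ with $p(\chi)(\widehat X)\neq0$,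 and every $k$-dimensional $X\in B_q(n)$ is the column space of exactly one $n\times k$ matrix in Schubert normal form. (3) $\mathbb C[B_q(n+1)]=\mathbb C[B_q(n)]\oplus W(0)\oplus\bigoplus_{\chi\in\mathcal N_q(n)}W(\chi)$; for $\beta\in\mathcal E_q(n)$ the vectors $v_{(\beta,0)}$, $v_{(\beta,1)}$ lie in $\mathbb C[B_q(n)]\oplus W(0)$, and $v_{(\beta,\chi)}\in W(\chi)$ for $\chi\in\mathcal N_q(n+1)$. (4) $M_q(n)\,v_\alpha=\big((n-k)_q-(k)_q\big)v_\alpha$ with $k=N(\alpha)$, for all $\alpha\in\mathcal E_q(n)$. (5) $\{v_\alpha:\alpha\in\mathcal E_q(n)\}$ (a family indexed by $\mathcal E_q(n)$) is a basis of $\mathbb C[B_q(n)]$. (6) This basis is orthogonal: $\langle v_\alpha,v_\beta\rangle_\pi=0$ for $\alpha\ne\beta$. -/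

import Mathlib

universe u

namespace QCube

noncomputable section

open Classical in
/-- The column space of all `n`-tuples over a finite field has finitely many subspaces. -/
instance fintypeSubspaces (F : Type u) [Field F] [Fintype F] (n : ℕ) :
    Fintype (Submodule F (Fin n → F)) := Fintype.ofFinite _

/-- `B_q(n)`: the set of all subspaces of `F^n`, where `F` is the field with `q` elements. -/
abbrev Bq (F : Type u) [Field F] (n : ℕ) : Type u := Submodule F (Fin n → F)

/-- The complex vector space `ℂ[B_q(n)]`, written as column vectors indexed by `B_q(n)`. -/
abbrev CB (F : Type u) [Field F] (n : ℕ) : Type u := Bq F n → ℂ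

/-- The dimension of a subspace. -/
abbrev dim {F : Type u} [Field F] {n : ℕ} (X : Bq F n) : ℕ := Module.finrank F X

/-- The order `q` of the field. -/
abbrev qq (F : Type u) [Fintype F] : ℕ := Fintype.card F

/-- `(m)_q = 1 + q + ⋯ + q^(m-1)`. -/
def qNum (F : Type u) [Fintype F] (m : ℕ) : ℕ := ∑ i ∈ Finset.range m, qq F ^ i

/-- The `q`-binomial coefficient: the number of `k`-dimensional subspaces of `F^n`. -/
def qBinom (F : Type u) [Field F] (n k : ℕ) : ℕ := Nat.card {X : Bq F n // dim X = k}

/-- The Galois number `G_q(n)`. -/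
def galoisNumber (F : Type u) [Field F] (n : ℕ) : ℕ := ∑ k ∈ Finset.range (n + 1), qBinom F n k

open Classical in
/-- The matrix `M_q(n)`. -/
def Mq (F : Type u) [Field F] [Fintype F] (n : ℕ) : Matrix (Bq F n) (Bq F n) ℂ :=
  Matrix.of fun X Y =>
    if Y ≤ X ∧ dim X = dim Y + 1 then 1
    else if X ≤ Y ∧ dim Y = dim X + 1 then (qq F : ℂ) ^ dim X
    else 0

/-- The weight `π(X) = q^(k choose 2) / P_q(n)`, `k = dim X`, `P_q(n) = ∏_{i<n} (1 + q^i)`. -/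
def piWeight {F : Type u} [Field F] [Fintype F] {n : ℕ} (X : Bq F n) : ℝ :=
  (qq F : ℝ) ^ (dim X).choose 2 / ∏ i ∈ Finset.range n, (1 + (qq F : ℝ) ^ i)

/-- The inner product `⟨u, v⟩_π = ∑_X conj (u X) * v X * π X`. -/
def piInner {F : Type u} [Field F] [Fintype F] {n : ℕ} (u v : CB F n) : ℂ :=
  ∑ X, starRingEnd ℂ (u X) * v X * (piWeight X : ℂ)

open Classical in
/-- The standard basis vector of `ℂ[B_q(n)]` belonging to the subspace `X`. -/
def ket {F : Type u} [Field F] {n : ℕ} (X : Bq F n) : CB F n := Pi.single X 1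

/-! ### The hyperplane `F^n` of `F^(n+1)` -/

/-- The identification of `F^n` with the vectors of `F^(n+1)` whose last component is zero. -/
def incl (F : Type u) [Field F] (n : ℕ) : (Fin n → F) →ₗ[F] (Fin (n + 1) → F) where
  toFun x := Fin.snoc (α := fun _ => F) x 0
  map_add' x y := by
    ext i
    refine Fin.lastCases ?_ (fun j => ?_) i <;> simp
  map_smul' c x := by
    ext i
    refine Fin.lastCases ?_ (fun j => ?_) i <;> simp

/-- `X ∈ B_q(n)` regarded as an element of `B_q(n+1)`. -/
def up {F : Type u} [Field F] {n : ℕ} (X : Bq F n) : Bq F (n + 1) := X.map (incl F n)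

/-- `A_q(n+1)`: the subspaces of `F^(n+1)` that are not contained in the hyperplane `F^n`. -/
def Aq (F : Type u) [Field F] (n : ℕ) : Set (Bq F (n + 1)) :=
  {Y | ¬ Y ≤ LinearMap.range (incl F n)}

/-- `X̂`: the span of `X ∈ B_q(n)` and the last standard basis vector of `F^(n+1)`. -/
def hat {F : Type u} [Field F] {n : ℕ} (X : Bq F n) : Bq F (n + 1) :=
  up X ⊔ Submodule.span F {Pi.single (Fin.last n) 1}

/-- The inclusion of `ℂ[B_q(n)]` in `ℂ[B_q(n+1)]`. -/
def embed (F : Type u) [Field F] [Fintype F] (n : ℕ) : CB F n →ₗ[ℂ] CB F (n + 1) :=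
  Fintype.linearCombination ℂ fun X : Bq F n => ket (up X)

open Classical in
/-- `θ_n`: the linear map taking `X` to the sum of all `Y ∈ A_q(n+1)` that cover `X`. -/
def theta (F : Type u) [Field F] [Fintype F] (n : ℕ) : CB F n →ₗ[ℂ] CB F (n + 1) :=
  Fintype.linearCombination ℂ fun X : Bq F n =>
    ∑ Y : Bq F (n + 1) with Y ∈ Aq F n ∧ up X ⋖ Y, ket Y

/-! ### The group `H(n+1, F)`, its characters and isotypic components -/

/-- `φ : F^n → GL(n+1, F)`: the vector `a` goes to the matrix with the identity in the upper left
`n × n` block, last column `(a_1, …, a_n, 1)` and last row `(0, …, 0, 1)`. -/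
def phi (F : Type u) [Field F] (n : ℕ) : Multiplicative (Fin n → F) →* GL (Fin (n + 1)) F :=
  MonoidHom.toHomUnits
    { toFun := fun a =>
        1 + Matrix.vecMulVec (incl F n a.toAdd) (Pi.single (Fin.last n) (1 : F))
      map_one' := by simp
      map_mul' := fun a b => by
        have h : (Pi.single (Fin.last n) (1 : F) : Fin (n + 1) → F) ⬝ᵥ incl F n b.toAdd = 0 := by
          simp [incl]
        rw [toAdd_mul, map_add, Matrix.add_vecMulVec, mul_add, add_mul, add_mul,
          Matrix.vecMulVec_mul_vecMulVec, h]
        simp [add_assoc] }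

/-- `H(n+1, F)` as a subgroup of `GL(n+1, F)`. -/
def H (F : Type u) [Field F] (n : ℕ) : Subgroup (GL (Fin (n + 1)) F) := (phi F n).range

instance fintypeH (F : Type u) [Field F] [Fintype F] (n : ℕ) : Fintype (H F n) :=
  Fintype.ofFinite _

/-- The irreducible characters of the abelian group `H(n+1, F)`, all of degree one;
`1` is the trivial one. -/
abbrev Char (F : Type u) [Field F] (n : ℕ) : Type u := H F n →* ℂˣ

/-- The left action of `H(n+1, F)` on `B_q(n+1)`. -/
def move {F : Type u} [Field F] {n : ℕ} (g : H F n) (Y : Bq F (n + 1)) : Bq F (n + 1) :=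
  Y.map (Matrix.mulVecLin (g : GL (Fin (n + 1)) F).val)

/-- The linear action of `H(n+1, F)` on `ℂ[B_q(n+1)]`. -/
def act {F : Type u} [Field F] [Fintype F] {n : ℕ} (g : H F n) :
    CB F (n + 1) →ₗ[ℂ] CB F (n + 1) :=
  Fintype.linearCombination ℂ fun Y : Bq F (n + 1) => ket (move g Y)

/-- `W(χ)`: the isotypic component, for the character `χ` of degree one, of the subspace
`ℂ[A_q(n+1)]` of `ℂ[B_q(n+1)]`. -/
def W {F : Type u} [Field F] [Fintype F] {n : ℕ} (χ : Char F n) :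
    Submodule ℂ (CB F (n + 1)) where
  carrier := {v | (∀ Y, Y ∉ Aq F n → v Y = 0) ∧ ∀ g : H F n, act g v = (χ g : ℂ) • v}
  add_mem' := by
    rintro u v ⟨hu, hu'⟩ ⟨hv, hv'⟩
    exact ⟨fun Y hY => by simp [hu Y hY, hv Y hY],
      fun g => by rw [map_add, hu', hv', smul_add]⟩
  zero_mem' := ⟨fun _ _ => rfl, fun g => by simp⟩
  smul_mem' := by
    rintro c v ⟨hv, hv'⟩
    exact ⟨fun Y hY => by simp [hv Y hY],
      fun g => by rw [map_smul, hv', smul_comm]⟩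

/-- `p(χ) = ∑_g conj (χ g) g`, acting on `ℂ[B_q(n+1)]`. -/
def p {F : Type u} [Field F] [Fintype F] {n : ℕ} (χ : Char F n) :
    CB F (n + 1) →ₗ[ℂ] CB F (n + 1) :=
  ∑ g : H F n, starRingEnd ℂ (χ g : ℂ) • act g

/-- The property that singles out `X(χ)`: a hyperplane `X` of `F^n` with `p(χ)(X̂) ≠ 0`. -/
def IsHyperplaneOf {F : Type u} [Field F] [Fintype F] {n : ℕ} (χ : Char F n) (X : Bq F n) : Prop :=
  dim X + 1 = n ∧ p χ (ket (hat X)) ≠ 0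

/-- `X(χ)`, for a nontrivial character `χ`: the unique hyperplane `X` with `p(χ)(X̂) ≠ 0`. -/
def hyperplane {F : Type u} [Field F] [Fintype F] {n : ℕ} (χ : Char F n) : Bq F n :=
  Classical.epsilon (IsHyperplaneOf χ)

/-- `λ(χ)`: the linear map with `Y ↦ q^(-dim Y) p(χ)(Ŷ)`. It is applied only to vectors supported
on the subspaces of `X(χ)`. -/
def lam {F : Type u} [Field F] [Fintype F] {n : ℕ} (χ : Char F n) : CB F n →ₗ[ℂ] CB F (n + 1) :=
  Fintype.linearCombination ℂ fun Y : Bq F n => ((qq F : ℂ) ^ dim Y)⁻¹ • p χ (ket (hat Y))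

/-! ### Schubert normal form -/

/-- Schubert normal form (column reduced echelon form): the last nonzero entry of column `j` is a
`1`, in row `r j`; the rows `r j` increase with `j`, and together form an identity matrix. -/
def IsSchubert {F : Type u} [Field F] {n k : ℕ} (M : Matrix (Fin n) (Fin k) F) : Prop :=
  ∃ r : Fin k → Fin n, StrictMono r ∧ (∀ j i, r j < i → M i j = 0) ∧ M.submatrix r id = 1

/-- `M` is in Schubert normal form and its column space is `X`. -/
def IsSchubertFormOf {F : Type u} [Field F] {n k : ℕ} (X : Bq F n)
    (M : Matrix (Fin n) (Fin k) F) : Prop :=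
  IsSchubert M ∧ Submodule.span F (Set.range M.col) = X

/-- The `n × k` matrix `M(X)` in Schubert normal form whose column space is the `k`-dimensional
subspace `X`. -/
def schubertForm {F : Type u} [Field F] {n : ℕ} (k : ℕ) (X : Bq F n) :
    Matrix (Fin n) (Fin k) F :=
  Classical.epsilon (IsSchubertFormOf X)

/-- `τ(X) : F^n → F^(n+1)`, with image the hyperplane `X`: the standard basis vector `e_j` goes to
column `j` of `M(X)`. -/
def tau {F : Type u} [Field F] {n : ℕ} (X : Bq F (n + 1)) : (Fin n → F) →ₗ[F] (Fin (n + 1) → F) :=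
  Matrix.mulVecLin (schubertForm n X)

/-- `μ(X)`: the linear map on `ℂ[B_q(n)]` induced by `Y ↦ τ(X)(Y)`. Its values are supported on the
subspaces of the hyperplane `X` of `F^(n+1)`. -/
def mu {F : Type u} [Field F] [Fintype F] {n : ℕ} (X : Bq F (n + 1)) :
    CB F n →ₗ[ℂ] CB F (n + 1) :=
  Fintype.linearCombination ℂ fun Y : Bq F n => ket (Y.map (tau X))

/-! ### The index set and the eigenvectors -/

/-- `E_q(n)`: sequences built from the empty one by appending at the end either `0` or `1`
(passing from `n` to `n+1`), or a nontrivial character of `H(n+2, F)` (passing from `n` to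
`n+2`). -/
inductive SeqE (F : Type u) [Field F] : ℕ → Type u
  | nil : SeqE F 0
  | zero {n : ℕ} (β : SeqE F n) : SeqE F (n + 1)
  | one {n : ℕ} (β : SeqE F n) : SeqE F (n + 1)
  | char {n : ℕ} (β : SeqE F n) (χ : Char F (n + 1)) (hχ : χ ≠ 1) : SeqE F (n + 2)

/-- `N(α)`: the number of nonzero entries of the sequence `α`. -/
def SeqE.N {F : Type u} [Field F] : {n : ℕ} → SeqE F n → ℕ
  | _, .nil => 0
  | _, .zero β => β.N
  | _, .one β => β.N + 1
  | _, .char β _ _ => β.N + 1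

/-- The vector `v_α`. -/
def SeqE.vec {F : Type u} [Field F] [Fintype F] : {n : ℕ} → SeqE F n → CB F n
  | _, .nil => ket ⊥
  | _, .zero (n := n) β => (qq F : ℂ) ^ β.N • embed F n β.vec + theta F n β.vec
  | _, .one (n := n) β => (qq F : ℂ) ^ (n - β.N) • embed F n β.vec - theta F n β.vec
  | _, .char β χ _ => lam χ (mu (hyperplane χ) β.vec)

end

end QCube

namespace QCube

open scoped Classical

/-! Relative to the hyperplane F^n, the subspaces of F^(n+1) are of two kinds: `up Y`, and `aff Y
a`, spanned by Y and (a, 1), where a matters only modulo Y. The group H(n+1, F) fixes the first kind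
and translates a in the second, so functions on the second kind split into Fourier modes `lam χ w`,
with value χ(-a) w(Y) at `aff Y a` if χ is trivial on Y and 0 otherwise. For χ ≠ 1 the surviving Y
are the subspaces of a single hyperplane, `kernel χ`.

The matrix M respects this splitting. By `mulVec_embed` and `mulVec_lam`, M(embed v) = embed(Mv) +
lam 1 v, and M(lam χ w) = q lam χ (Mw), plus q^n embed w if χ = 1, for w supported where χ is
trivial. Hence an eigenvector v spans with θ(v) = lam 1 v an invariant space of embed v and lam 1 v,
whose 2×2 matrix is diagonalized by the vectors for the new entries 0 and 1. For χ ≠ 1 the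
hyperplane carries a smaller copy of M (`lam_mulVec_push`), and the eigenvalue is multiplied by q:
q((n-k)_q - (k)_q) = (n-k+1)_q - (k+1)_q.

Orthogonality is inherited: embed, `push` into the hyperplane and lam χ (on functions supported
where χ is trivial) scale the inner product by constants, while embed is orthogonal to every lam χ
and different characters are orthogonal. The one remaining pair, (β,0) and (β,1), gives q^k q^(n-k)
- q^n = 0. Nonzero orthogonal vectors are independent; that there are enough of them is the
Goldman–Rota recurrence `qBinom_add_two`, which the definition of E_q(n) mirrors. -/

theorem forall_snoc {F : Type u} {n : ℕ} {P : (Fin (n + 1) → F) → Prop} :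
    (∀ z, P z) ↔ ∀ (x : Fin n → F) (c : F), P (Fin.snoc (α := fun _ => F) x c) :=
  ⟨fun h x c => h _, fun h z => by simpa using h (Fin.init z) (z (Fin.last n))⟩

theorem snoc_eq_snoc {F : Type u} {n : ℕ} {x y : Fin n → F} {c d : F} :
    (Fin.snoc (α := fun _ => F) x c : Fin (n + 1) → F) = Fin.snoc (α := fun _ => F) y d ↔
      x = y ∧ c = d := by
  constructor
  · intro h
    exact ⟨by simpa using congrArg Fin.init h, by simpa using congrFun h (Fin.last n)⟩
  · rintro ⟨rfl, rfl⟩; rfl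

variable {F : Type u} [Field F] {n m : ℕ}

/-! ### Subspaces of `F^(n+1)` in terms of subspaces of `F^n` -/

theorem incl_apply (x : Fin n → F) :
    incl F n x = (Fin.snoc (α := fun _ => F) x 0 : Fin (n + 1) → F) := rfl

theorem incl_injective : Function.Injective (incl F n) := by
  intro x y h
  exact (snoc_eq_snoc.1 h).1

theorem mem_range_incl {x : Fin n → F} {c : F} :
    (Fin.snoc (α := fun _ => F) x c : Fin (n + 1) → F) ∈ LinearMap.range (incl F n) ↔ c = 0 := by
  constructor
  · rintro ⟨y, hy⟩
    exact ((snoc_eq_snoc.1 hy).2).symm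
  · rintro rfl
    exact ⟨x, rfl⟩

theorem mem_up {Y : Bq F n} {x : Fin n → F} {c : F} :
    (Fin.snoc (α := fun _ => F) x c : Fin (n + 1) → F) ∈ up Y ↔ c = 0 ∧ x ∈ Y := by
  constructor
  · rintro ⟨y, hy, h⟩
    exact ⟨(snoc_eq_snoc.1 h).2.symm, (snoc_eq_snoc.1 h).1 ▸ hy⟩
  · rintro ⟨rfl, hx⟩
    exact ⟨x, hx, rfl⟩

theorem up_le_range (Y : Bq F n) : up Y ≤ LinearMap.range (incl F n) := LinearMap.map_le_range

/-- The subspace of `F^(n+1)` spanned by `Y` and the vector `(a, 1)`. -/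
def aff (Y : Bq F n) (a : Fin n → F) : Bq F (n + 1) :=
  Y.comap (LinearMap.funLeft F F Fin.castSucc -
    (LinearMap.proj (R := F) (φ := fun _ : Fin (n + 1) => F) (Fin.last n)).smulRight a)

theorem mem_aff {Y : Bq F n} {a x : Fin n → F} {c : F} :
    (Fin.snoc (α := fun _ => F) x c : Fin (n + 1) → F) ∈ aff Y a ↔ x - c • a ∈ Y := by
  have : (Fin.snoc (α := fun _ => F) x c : Fin (n + 1) → F) ∘ Fin.castSucc = x := by
    ext i; simp
  simp [aff, LinearMap.funLeft, this]

theorem up_le_up {X Y : Bq F n} : up X ≤ up Y ↔ X ≤ Y :=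
  Submodule.map_le_map_iff_of_injective incl_injective X Y

theorem up_injective : Function.Injective (up : Bq F n → Bq F (n + 1)) :=
  Submodule.map_injective_of_injective incl_injective

theorem up_le_aff {X Y : Bq F n} {a : Fin n → F} : up X ≤ aff Y a ↔ X ≤ Y := by
  constructor
  · intro h x hx
    have := h (mem_up.2 ⟨rfl, hx⟩)
    simpa [mem_aff] using this
  · intro h
    refine forall_snoc.2 fun x c hx => ?_
    obtain ⟨rfl, hx'⟩ := mem_up.1 hx
    simpa [mem_aff] using h hx'

theorem snoc_one_mem_aff (Y : Bq F n) (a : Fin n → F) :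
    (Fin.snoc (α := fun _ => F) a 1 : Fin (n + 1) → F) ∈ aff Y a := by
  simp [mem_aff]

theorem aff_mem_Aq (Y : Bq F n) (a : Fin n → F) : aff Y a ∈ Aq F n := fun h =>
  one_ne_zero (mem_range_incl.1 (h (snoc_one_mem_aff Y a)))

theorem up_notMem_Aq (Y : Bq F n) : up Y ∉ Aq F n := fun h => h (up_le_range Y)

theorem not_aff_le_up {X Y : Bq F n} {a : Fin n → F} : ¬ aff Y a ≤ up X := fun h =>
  aff_mem_Aq Y a (h.trans (up_le_range X))

theorem aff_ne_up {X Y : Bq F n} {a : Fin n → F} : aff Y a ≠ up X := fun h =>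
  not_aff_le_up h.le

theorem aff_le_aff {X Y : Bq F n} {a b : Fin n → F} : aff X a ≤ aff Y b ↔ X ≤ Y ∧ a - b ∈ Y := by
  constructor
  · intro h
    refine ⟨fun x hx => ?_, ?_⟩
    · have : (Fin.snoc (α := fun _ => F) x 0 : Fin (n + 1) → F) ∈ aff X a := by
        simpa [mem_aff] using hx
      simpa [mem_aff] using h this
    · simpa [mem_aff] using h (snoc_one_mem_aff X a)
  · rintro ⟨h, hab⟩
    refine forall_snoc.2 fun x c hx => ?_
    rw [mem_aff] at hx ⊢
    have := Y.add_mem (h hx) (Y.smul_mem c hab)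
    convert this using 1
    rw [smul_sub]; abel

theorem aff_eq_aff {X Y : Bq F n} {a b : Fin n → F} : aff X a = aff Y b ↔ X = Y ∧ a - b ∈ Y := by
  constructor
  · intro h
    have h1 := aff_le_aff.1 h.le
    have h2 := aff_le_aff.1 h.ge
    exact ⟨le_antisymm h1.1 h2.1, h1.2⟩
  · rintro ⟨rfl, h⟩
    refine le_antisymm (aff_le_aff.2 ⟨le_rfl, h⟩) (aff_le_aff.2 ⟨le_rfl, ?_⟩)
    simpa using X.neg_mem h

/-- A vector of Z outside the hyperplane can be scaled to (a, 1); subtracting multiples of it moves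
the rest of Z into Z ∩ F^n, which serves as Y. -/
theorem up_or_aff (Z : Bq F (n + 1)) : (∃ Y, Z = up Y) ∨ ∃ Y a, Z = aff Y a := by
  by_cases h : Z ≤ LinearMap.range (incl F n)
  · exact Or.inl ⟨Z.comap (incl F n), (Submodule.map_comap_eq_of_le h).symm⟩
  · right
    obtain ⟨z, hz, hz'⟩ := SetLike.not_le_iff_exists.1 h
    revert hz hz'
    refine forall_snoc (P := fun z => z ∈ Z → z ∉ LinearMap.range (incl F n) → _).2 ?_ z
    intro x c hz hz'
    have hc : c ≠ 0 := fun hc => hz' (mem_range_incl.2 hc)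
    have ha : (Fin.snoc (α := fun _ => F) (c⁻¹ • x) 1 : Fin (n + 1) → F) ∈ Z := by
      convert Z.smul_mem c⁻¹ hz using 1
      ext i
      refine Fin.lastCases ?_ (fun j => ?_) i <;> simp [hc]
    refine ⟨Z.comap (incl F n), c⁻¹ • x, ?_⟩
    have key : ∀ (y : Fin n → F) (d : F),
        incl F n (y - d • c⁻¹ • x) =
          (Fin.snoc (α := fun _ => F) y d : Fin (n + 1) → F) -
            d • (Fin.snoc (α := fun _ => F) (c⁻¹ • x) 1 : Fin (n + 1) → F) := by
      intro y d
      ext i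
      refine Fin.lastCases ?_ (fun j => ?_) i <;> simp [incl_apply]
    refine SetLike.ext (forall_snoc.2 fun y d => ?_)
    rw [mem_aff, Submodule.mem_comap, key]
    exact (Z.sub_mem_iff_left (Z.smul_mem d ha)).symm

theorem exists_aff_of_mem_Aq {Z : Bq F (n + 1)} (h : Z ∈ Aq F n) : ∃ Y a, Z = aff Y a := by
  rcases up_or_aff Z with ⟨Y, rfl⟩ | h'
  · exact absurd h (up_notMem_Aq Y)
  · exact h'

theorem exists_up_of_notMem_Aq {Z : Bq F (n + 1)} (h : Z ∉ Aq F n) : ∃ Y, Z = up Y := by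
  rcases up_or_aff Z with h' | ⟨Y, a, rfl⟩
  · exact h'
  · exact absurd (aff_mem_Aq Y a) h

theorem hat_eq_aff (Y : Bq F n) : hat Y = aff Y 0 := by
  have he : (Pi.single (Fin.last n) 1 : Fin (n + 1) → F) = Fin.snoc (α := fun _ => F) 0 1 := by
    ext i
    refine Fin.lastCases ?_ (fun j => ?_) i <;> simp
  rw [hat, he]
  refine le_antisymm (sup_le (up_le_aff.2 le_rfl) ?_) ?_
  · rw [Submodule.span_singleton_le_iff_mem]
    exact snoc_one_mem_aff Y 0
  · refine forall_snoc.2 fun x c hx => ?_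
    have hx : x ∈ Y := by simpa [mem_aff] using hx
    have : (Fin.snoc (α := fun _ => F) x c : Fin (n + 1) → F) =
        Fin.snoc (α := fun _ => F) x 0 + c • Fin.snoc (α := fun _ => F) 0 1 := by
      ext i
      refine Fin.lastCases ?_ (fun j => ?_) i <;> simp
    rw [this]
    exact Submodule.add_mem_sup (mem_up.2 ⟨rfl, hx⟩)
      (Submodule.smul_mem _ _ (Submodule.mem_span_singleton_self _))

theorem dim_map_of_injective {f : (Fin n → F) →ₗ[F] (Fin m → F)} (hf : Function.Injective f)
    (Y : Bq F n) : dim (Y.map f) = dim Y :=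
  (Submodule.equivMapOfInjective f hf Y).finrank_eq.symm

@[simp] theorem dim_up (Y : Bq F n) : dim (up Y) = dim Y := dim_map_of_injective incl_injective Y

@[simp] theorem dim_aff (Y : Bq F n) (a : Fin n → F) : dim (aff Y a) = dim Y + 1 := by
  -- The last coordinate maps `aff Y a` onto F with kernel `up Y`; rank-nullity gives the dimension.
  let f : aff Y a →ₗ[F] F :=
    (LinearMap.proj (R := F) (φ := fun _ : Fin (n + 1) => F) (Fin.last n)).domRestrict (aff Y a)
  have hr : LinearMap.range f = ⊤ := by
    refine LinearMap.range_eq_top.2 fun c =>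
      ⟨c • ⟨_, snoc_one_mem_aff Y a⟩, by simp [f]⟩
  have hk : (LinearMap.ker f).map (aff Y a).subtype = up Y := by
    refine SetLike.ext (forall_snoc.2 fun x c => ?_)
    rw [mem_up]
    constructor
    · rintro ⟨⟨z, hz⟩, h1, h2⟩
      simp only [Submodule.subtype_apply] at h2
      subst h2
      have hc : c = 0 := by simpa [f] using h1
      subst hc
      exact ⟨rfl, by simpa [mem_aff] using hz⟩
    · rintro ⟨rfl, hx⟩
      exact ⟨⟨_, mem_aff.2 (by simpa using hx)⟩, by simp [f], rfl⟩
  have h1 := LinearMap.finrank_range_add_finrank_ker f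
  have h2 := (Submodule.equivMapOfInjective _ (aff Y a).injective_subtype
    (LinearMap.ker f)).finrank_eq
  rw [hr, finrank_top, Module.finrank_self] at h1
  rw [hk] at h2
  have h3 := dim_up Y
  simp only [dim] at *
  omega

/-! ### Sums over the subspaces of `F^(n+1)` -/

variable [Fintype F]

theorem qq_ne_zero : (qq F : ℂ) ≠ 0 := Nat.cast_ne_zero.2 Fintype.card_ne_zero

theorem card_subspace (Y : Bq F n) : Fintype.card Y = qq F ^ dim Y :=
  Module.card_eq_pow_finrank

theorem sum_subspace_translate (Y : Bq F n) (a : Fin n → F) (f : (Fin n → F) → ℂ) :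
    ∑ b, (if b - a ∈ Y then f b else 0) = ∑ y : Y, f (a + y) := by
  rw [← Equiv.sum_comp (Equiv.addLeft a), ← Finset.sum_filter]
  simp only [Equiv.coe_addLeft, add_sub_cancel_left]
  exact (Finset.sum_subtype (Finset.univ.filter fun b => b ∈ Y) (by simp) fun b => f (a + b))

theorem card_translate (Y : Bq F n) (a : Fin n → F) :
    ∑ b, (if b - a ∈ Y then 1 else 0 : ℂ) = (qq F : ℂ) ^ dim Y := by
  rw [sum_subspace_translate Y a fun _ => 1]
  simp [card_subspace]

/-- Each member of A_q(n+1) is `aff Y a` for one Y and a whole coset of vectors a, so the free sum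
over a counts it q^(dim Y) times. Summing over all of F^n is what lets character sums be applied. -/
theorem sum_Bq_succ (f : Bq F (n + 1) → ℂ) :
    ∑ Z, f Z = ∑ Y : Bq F n, f (up Y) +
      ∑ Y : Bq F n, ((qq F : ℂ) ^ dim Y)⁻¹ * ∑ a, f (aff Y a) := by
  rw [← Finset.sum_filter_not_add_sum_filter Finset.univ (· ∈ Aq F n) f]
  congr 1
  · refine (Finset.sum_bij (fun Y _ => up Y) ?_ ?_ ?_ ?_).symm
    · intro Y _
      simpa using up_notMem_Aq Y
    · intro X _ Y _ h
      exact up_injective h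
    · intro Z hZ
      obtain ⟨Y, rfl⟩ := exists_up_of_notMem_Aq (Finset.mem_filter.1 hZ).2
      exact ⟨Y, Finset.mem_univ _, rfl⟩
    · intro Y _; rfl
  · have h1 : ∀ (Y : Bq F n) (a : Fin n → F),
        f (aff Y a) = ∑ Z with Z ∈ Aq F n, if Z = aff Y a then f Z else 0 := by
      intro Y a
      rw [Finset.sum_ite_eq' (Finset.univ.filter (· ∈ Aq F n)) (aff Y a) f,
        if_pos (by simpa using aff_mem_Aq Y a)]
    simp_rw [h1, Finset.mul_sum]
    rw [Finset.sum_congr rfl fun Y _ => Finset.sum_comm, Finset.sum_comm]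
    refine Finset.sum_congr rfl fun Z hZ => ?_
    obtain ⟨X, a, rfl⟩ := exists_aff_of_mem_Aq (Finset.mem_filter.1 hZ).2
    rw [Finset.sum_eq_single X]
    · have h2 : ∀ b, (if aff X a = aff X b then f (aff X a) else 0) =
          (if b - a ∈ X then 1 else 0) * f (aff X a) := by
        intro b
        have : aff X a = aff X b ↔ b - a ∈ X := by
          rw [eq_comm, aff_eq_aff]; simp
        simp [this]
      simp_rw [h2]
      rw [← Finset.mul_sum, ← Finset.sum_mul, card_translate, inv_mul_cancel_left₀]
      exact pow_ne_zero _ qq_ne_zero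
    · intro Y _ hY
      refine Finset.sum_eq_zero fun b _ => ?_
      rw [if_neg, mul_zero]
      exact fun h => hY (aff_eq_aff.1 h).1.symm
    · simp

end QCube

namespace QCube

open scoped Classical

variable {F : Type u} [Field F] {n m : ℕ}

theorem ket_apply (X Z : Bq F n) : ket X Z = if Z = X then 1 else 0 := by
  rw [ket, Pi.single_apply]

theorem CB_ext {u v : CB F (n + 1)} (h₁ : ∀ Y, u (up Y) = v (up Y))
    (h₂ : ∀ Y a, u (aff Y a) = v (aff Y a)) : u = v := by
  funext Z
  rcases up_or_aff Z with ⟨Y, rfl⟩ | ⟨Y, a, rfl⟩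
  · exact h₁ Y
  · exact h₂ Y a

/-! ### The group `H(n+1, F)` and its characters -/

theorem phi_mulVec_snoc (b x : Fin n → F) (c : F) :
    Matrix.mulVecLin (phi F n (Multiplicative.ofAdd b)).val (Fin.snoc (α := fun _ => F) x c) =
      Fin.snoc (α := fun _ => F) (x + c • b) c := by
  have h : (phi F n (Multiplicative.ofAdd b)).val =
      1 + Matrix.vecMulVec (incl F n b) (Pi.single (Fin.last n) (1 : F)) := rfl
  rw [Matrix.mulVecLin_apply, h, Matrix.add_mulVec, Matrix.one_mulVec, Matrix.vecMulVec_mulVec]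
  ext i
  refine Fin.lastCases ?_ (fun j => ?_) i <;> simp [incl_apply]

theorem phi_injective : Function.Injective (phi F n) := by
  intro a b h
  have ha := phi_mulVec_snoc a.toAdd 0 (1 : F)
  have hb := phi_mulVec_snoc b.toAdd 0 (1 : F)
  rw [ofAdd_toAdd] at ha hb
  rw [h, hb] at ha
  have := (snoc_eq_snoc.1 ha).1
  simpa using this.symm

/-- The isomorphism of `F^n` with `H(n+1, F)`. -/
noncomputable def hEquiv (F : Type u) [Field F] (n : ℕ) :
    Multiplicative (Fin n → F) ≃* H F n :=
  MonoidHom.ofInjective phi_injective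

theorem mulVec_injective (g : H F n) : Function.Injective (Matrix.mulVecLin g.1.val) :=
  Matrix.mulVec_injective_of_isUnit g.1.isUnit

theorem move_up (b : Fin n → F) (Y : Bq F n) :
    move (hEquiv F n (Multiplicative.ofAdd b)) (up Y) = up Y := by
  rw [move, up, ← Submodule.map_comp]
  congr 1
  exact LinearMap.ext fun x => (phi_mulVec_snoc b x 0).trans (by simp [incl_apply])

theorem move_aff (a b : Fin n → F) (Y : Bq F n) :
    move (hEquiv F n (Multiplicative.ofAdd b)) (aff Y a) = aff Y (a + b) := by
  refine SetLike.ext (forall_snoc.2 fun x c => ?_)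
  rw [mem_aff, move, Submodule.mem_map]
  constructor
  · rintro ⟨z, hz, h⟩
    revert hz h
    refine forall_snoc (P := fun z => z ∈ _ → _ = _ → _).2 (fun y d hz h => ?_) z
    obtain ⟨rfl, rfl⟩ := snoc_eq_snoc.1 ((phi_mulVec_snoc b y d).symm.trans h)
    rw [mem_aff] at hz
    convert hz using 1
    rw [smul_add]; abel
  · intro h
    refine ⟨Fin.snoc (α := fun _ => F) (x - c • b) c, mem_aff.2 ?_,
      (phi_mulVec_snoc b _ c).trans (by simp)⟩
    convert h using 1
    rw [smul_add]; abel

/-- The characters of `H(n+1, F)` as additive characters of `F^n`. -/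
noncomputable def addChar (χ : Char F n) : AddChar (Fin n → F) ℂ where
  toFun a := (χ (hEquiv F n (Multiplicative.ofAdd a)) : ℂ)
  map_zero_eq_one' := by simp
  map_add_eq_mul' a b := by simp [ofAdd_add]

theorem addChar_apply (χ : Char F n) (a : Fin n → F) :
    addChar χ a = (χ (hEquiv F n (Multiplicative.ofAdd a)) : ℂ) := rfl

/-- Carries orthogonality and counting of additive characters of F^n over to H(n+1, F). -/
theorem addChar_bijective : Function.Bijective (addChar (F := F) (n := n)) := by
  constructor
  · intro χ ψ h
    ext g
    obtain ⟨a, rfl⟩ := (hEquiv F n).surjective g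
    exact DFunLike.congr_fun h a.toAdd
  · intro ψ
    refine ⟨(MonoidHom.toHomUnits ψ.toMonoidHom).comp (hEquiv F n).symm.toMonoidHom, ?_⟩
    ext a
    simp [addChar_apply]

theorem addChar_one : addChar (1 : Char F n) = 0 := by
  ext a
  simp [addChar_apply]

theorem addChar_eq_zero {χ : Char F n} : addChar χ = 0 ↔ χ = 1 := by
  rw [← addChar_one, addChar_bijective.1.eq_iff]

/-- The subspaces on which the character `χ` is trivial. -/
def IsTrivialOn (χ : Char F n) (Y : Bq F n) : Prop := ∀ y ∈ Y, addChar χ y = 1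

theorem isTrivialOn_one (Y : Bq F n) : IsTrivialOn 1 Y := fun y _ => by simp [addChar_one]

theorem IsTrivialOn.mono {χ : Char F n} {X Y : Bq F n} (h : IsTrivialOn χ Y) (hXY : X ≤ Y) :
    IsTrivialOn χ X := fun x hx => h x (hXY hx)

variable [Fintype F]

/-! ### Linear maps induced by linear maps of the underlying spaces -/

/-- The linear map `ℂ[B_q(n)] → ℂ[B_q(m)]` induced by `Y ↦ f(Y)`. -/
noncomputable def push (f : (Fin n → F) →ₗ[F] (Fin m → F)) : CB F n →ₗ[ℂ] CB F m :=
  Fintype.linearCombination ℂ fun Y : Bq F n => ket (Y.map f)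

theorem embed_eq_push : embed F n = push (incl F n) := rfl

theorem mu_eq_push (X : Bq F (n + 1)) : mu X = push (tau X) := rfl

/-- The transpose of `push`; it reduces matrix products and inner products with pushed vectors to
sums over B_q(n). -/
theorem sum_mul_push (f : (Fin n → F) →ₗ[F] (Fin m → F)) (v : CB F n) (g : Bq F m → ℂ) :
    ∑ Z, g Z * push f v Z = ∑ Y, g (Y.map f) * v Y := by
  simp only [push, Fintype.linearCombination_apply, Finset.sum_apply, Pi.smul_apply, ket_apply,
    smul_eq_mul, Finset.mul_sum]
  rw [Finset.sum_comm]
  simp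

theorem push_map {f : (Fin n → F) →ₗ[F] (Fin m → F)} (hf : Function.Injective f) (v : CB F n)
    (Y : Bq F n) : push f v (Y.map f) = v Y := by
  simp [push, Fintype.linearCombination_apply, ket_apply,
    (Submodule.map_injective_of_injective hf).eq_iff]

theorem push_eq_zero {f : (Fin n → F) →ₗ[F] (Fin m → F)} (v : CB F n) {Z : Bq F m}
    (hZ : ¬ Z ≤ LinearMap.range f) : push f v Z = 0 := by
  simp only [push, Fintype.linearCombination_apply, Finset.sum_apply, Pi.smul_apply, ket_apply,
    smul_eq_mul]
  refine Finset.sum_eq_zero fun Y _ => ?_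
  rw [if_neg, mul_zero]
  rintro rfl
  exact hZ LinearMap.map_le_range

@[simp] theorem embed_up (v : CB F n) (Y : Bq F n) : embed F n v (up Y) = v Y :=
  push_map incl_injective v Y

@[simp] theorem embed_aff (v : CB F n) (Y : Bq F n) (a : Fin n → F) :
    embed F n v (aff Y a) = 0 :=
  push_eq_zero v (aff_mem_Aq Y a)

theorem act_move (g : H F n) (v : CB F (n + 1)) (Z : Bq F (n + 1)) : act g v (move g Z) = v Z :=
  push_map (mulVec_injective g) v Z

/-! ### Character sums and closed forms of p(χ), λ(χ) and θ -/

theorem sum_addChar_subspace (χ : Char F n) (Y : Bq F n) :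
    ∑ y : Y, addChar χ (-y) = if IsTrivialOn χ Y then (qq F : ℂ) ^ dim Y else 0 := by
  have h := AddChar.sum_eq_ite ((addChar χ).compAddMonoidHom Y.subtype.toAddMonoidHom)
  have h' : (addChar χ).compAddMonoidHom Y.subtype.toAddMonoidHom = 0 ↔ IsTrivialOn χ Y := by
    rw [AddChar.eq_zero_iff]
    simp [IsTrivialOn]
  rw [← Equiv.sum_comp (Equiv.neg Y)]
  simp only [h', card_subspace] at h
  simpa using h

theorem sum_addChar_translate (χ : Char F n) (Y : Bq F n) (a : Fin n → F) :
    ∑ b, (if b - a ∈ Y then addChar χ (-b) else 0) =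
      if IsTrivialOn χ Y then (qq F : ℂ) ^ dim Y * addChar χ (-a) else 0 := by
  rw [sum_subspace_translate Y a fun b => addChar χ (-b)]
  simp only [neg_add, AddChar.map_add_eq_mul]
  rw [← Finset.mul_sum, sum_addChar_subspace]
  split_ifs <;> ring

theorem sum_addChar (χ : Char F n) :
    ∑ b, addChar χ b = if χ = 1 then (qq F : ℂ) ^ n else 0 := by
  rw [AddChar.sum_eq_ite]
  simp [addChar_eq_zero]

theorem conj_addChar (χ : Char F n) (a : Fin n → F) :
    starRingEnd ℂ (addChar χ a) = addChar χ (-a) := (AddChar.map_neg_eq_conj _ _).symm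

theorem act_aff (a b : Fin n → F) (v : CB F (n + 1)) (Y : Bq F n) :
    act (hEquiv F n (Multiplicative.ofAdd b)) v (aff Y a) = v (aff Y (a - b)) := by
  rw [← act_move (hEquiv F n (Multiplicative.ofAdd b)) v (aff Y (a - b)), move_aff, sub_add_cancel]

theorem act_up (b : Fin n → F) (v : CB F (n + 1)) (Y : Bq F n) :
    act (hEquiv F n (Multiplicative.ofAdd b)) v (up Y) = v (up Y) := by
  rw [← act_move (hEquiv F n (Multiplicative.ofAdd b)) v (up Y), move_up]

theorem p_apply (χ : Char F n) (v : CB F (n + 1)) (Z : Bq F (n + 1)) :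
    p χ v Z =
      ∑ b, addChar χ (-b) * act (hEquiv F n (Multiplicative.ofAdd b)) v Z := by
  simp only [p, LinearMap.sum_apply, LinearMap.smul_apply, Finset.sum_apply, Pi.smul_apply,
    smul_eq_mul]
  rw [← Equiv.sum_comp (Multiplicative.ofAdd.trans (hEquiv F n).toEquiv)]
  refine Finset.sum_congr rfl fun b _ => ?_
  rw [← conj_addChar]
  rfl

theorem p_aff (χ : Char F n) (v : CB F (n + 1)) (Y : Bq F n) (a : Fin n → F) :
    p χ v (aff Y a) = ∑ b, addChar χ (-b) * v (aff Y (a - b)) := by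
  simp_rw [p_apply, act_aff]

theorem p_ket_hat_up (χ : Char F n) (X Y : Bq F n) : p χ (ket (hat Y)) (up X) = 0 := by
  simp_rw [p_apply, act_up, ket_apply, hat_eq_aff, if_neg aff_ne_up.symm]
  simp

/-- The translates of `hat Y` are the `aff Y b`, and b gives `aff Y a` exactly on the coset a + Y.
The character sum over this coset vanishes unless χ is trivial on Y. -/
theorem p_ket_hat_aff (χ : Char F n) (X Y : Bq F n) (a : Fin n → F) :
    p χ (ket (hat Y)) (aff X a) =
      if X = Y ∧ IsTrivialOn χ Y then (qq F : ℂ) ^ dim Y * addChar χ (-a) else 0 := by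
  simp_rw [p_aff, ket_apply, hat_eq_aff, aff_eq_aff, sub_zero]
  by_cases h : X = Y
  · subst h
    simp only [true_and, mul_ite, mul_one, mul_zero]
    rw [← sum_addChar_translate]
    refine Finset.sum_congr rfl fun b _ => ?_
    rw [← X.neg_mem_iff, neg_sub]
  · simp [h]

theorem lam_apply (χ : Char F n) (w : CB F n) (Z : Bq F (n + 1)) :
    lam χ w Z = ∑ Y, w Y * (((qq F : ℂ) ^ dim Y)⁻¹ * p χ (ket (hat Y)) Z) := by
  simp [lam, Fintype.linearCombination_apply]

@[simp] theorem lam_up (χ : Char F n) (w : CB F n) (Y : Bq F n) : lam χ w (up Y) = 0 := by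
  simp [lam_apply, p_ket_hat_up]

-- The factor q^(-dim Y) in λ(χ) cancels the size of the stabilizer Y of `hat Y`.
@[simp] theorem lam_aff (χ : Char F n) (w : CB F n) (Y : Bq F n) (a : Fin n → F) :
    lam χ w (aff Y a) = if IsTrivialOn χ Y then addChar χ (-a) * w Y else 0 := by
  rw [lam_apply, Finset.sum_eq_single Y]
  · rw [p_ket_hat_aff]
    by_cases h : IsTrivialOn χ Y
    · simp only [h, and_self, if_true]
      rw [inv_mul_cancel_left₀ (pow_ne_zero _ qq_ne_zero), mul_comm]
    · simp [h]
  · intro X _ hX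
    simp [p_ket_hat_aff, hX.symm]
  · simp

/-- The members of A_q(n+1) covering X are the `aff X a`, so θ is the mode of the trivial character
and needs no separate treatment. -/
theorem theta_eq_lam : theta F n = lam (1 : Char F n) := by
  have hcov : ∀ (X Y : Bq F n) (a : Fin n → F), up X ⋖ aff Y a ↔ Y = X := by
    intro X Y a
    constructor
    · intro h
      have h1 : up X ≤ up Y := up_le_up.2 (up_le_aff.1 h.le)
      have h2 : up Y < aff Y a := lt_of_le_of_ne (up_le_aff.2 le_rfl) aff_ne_up.symm
      by_contra hne
      exact h.2 (lt_of_le_of_ne h1 fun h => hne (up_injective h).symm) h2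
    · rintro rfl
      refine ⟨lt_of_le_of_ne (up_le_aff.2 le_rfl) aff_ne_up.symm, fun Z h1 h2 => ?_⟩
      have h1 := Submodule.finrank_lt_finrank_of_lt h1
      have h2 := Submodule.finrank_lt_finrank_of_lt h2
      have h3 := dim_up Y
      have h4 := dim_aff Y a
      simp only [dim] at h3 h4
      omega
  refine LinearMap.ext fun w => CB_ext (fun Y => ?_) fun Y a => ?_
  · simp [theta, Fintype.linearCombination_apply, ket_apply, up_notMem_Aq]
  · simp [theta, Fintype.linearCombination_apply, ket_apply, isTrivialOn_one,
      aff_mem_Aq, hcov, addChar_one]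

theorem lam_mem_W (χ : Char F n) (w : CB F n) : lam χ w ∈ W χ := by
  refine ⟨fun Z hZ => ?_, fun g => ?_⟩
  · obtain ⟨Y, rfl⟩ := exists_up_of_notMem_Aq hZ
    exact lam_up χ w Y
  · obtain ⟨b, rfl⟩ := (hEquiv F n).surjective g
    refine CB_ext (fun Y => ?_) fun Y a => ?_
    · simpa using act_up b.toAdd (lam χ w) Y
    · refine (act_aff a b.toAdd (lam χ w) Y).trans ?_
      have : addChar χ (-(a - b.toAdd)) = (χ (hEquiv F n b) : ℂ) * addChar χ (-a) := by
        rw [neg_sub, sub_eq_add_neg, AddChar.map_add_eq_mul]; rfl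
      rw [Pi.smul_apply, lam_aff, lam_aff, this]
      split_ifs <;> simp [mul_assoc]

end QCube

namespace QCube

open scoped Classical

variable {F : Type u} [Field F] [Fintype F] {n m : ℕ}

/-! ### The action of the matrix `M_q(n)` -/

theorem Mq_apply (X Y : Bq F n) :
    Mq F n X Y = if Y ≤ X ∧ dim X = dim Y + 1 then 1
      else if X ≤ Y ∧ dim Y = dim X + 1 then (qq F : ℂ) ^ dim X else 0 := rfl

theorem Mq_map {f : (Fin n → F) →ₗ[F] (Fin m → F)} (hf : Function.Injective f) (X Y : Bq F n) :
    Mq F m (X.map f) (Y.map f) = Mq F n X Y := by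
  simp only [Mq_apply, dim_map_of_injective hf, Submodule.map_le_map_iff_of_injective hf]

theorem mulVec_push_map {f : (Fin n → F) →ₗ[F] (Fin m → F)} (hf : Function.Injective f)
    (v : CB F n) (X : Bq F n) :
    (Mq F m).mulVec (push f v) (X.map f) = (Mq F n).mulVec v X := by
  simp only [Matrix.mulVec, dotProduct, sum_mul_push, Mq_map hf]

theorem Mq_aff_up (X Y : Bq F n) (a : Fin n → F) :
    Mq F (n + 1) (aff Y a) (up X) = if X = Y then 1 else 0 := by
  have h : (X ≤ Y ∧ dim Y = dim X) ↔ X = Y :=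
    ⟨fun h => Submodule.eq_of_le_of_finrank_eq h.1 h.2.symm, by rintro rfl; simp⟩
  simp only [Mq_apply, up_le_aff, dim_aff, dim_up, not_aff_le_up, false_and, if_false,
    Nat.add_right_cancel_iff, h]

theorem Mq_up_aff (X Y : Bq F n) (a : Fin n → F) :
    Mq F (n + 1) (up Y) (aff X a) = if X = Y then (qq F : ℂ) ^ dim Y else 0 := by
  have h : (Y ≤ X ∧ dim X = dim Y) ↔ X = Y :=
    ⟨fun h => (Submodule.eq_of_le_of_finrank_eq h.1 h.2.symm).symm, by rintro rfl; simp⟩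
  simp only [Mq_apply, up_le_aff, dim_aff, dim_up, not_aff_le_up, false_and, if_false,
    Nat.add_right_cancel_iff, h]

theorem Mq_aff_aff (X Y : Bq F n) (a b : Fin n → F) :
    Mq F (n + 1) (aff Y a) (aff X b) =
      if X ≤ Y ∧ dim Y = dim X + 1 then (if b - a ∈ Y then 1 else 0)
      else if Y ≤ X ∧ dim X = dim Y + 1 then
        (if b - a ∈ X then (qq F : ℂ) ^ (dim Y + 1) else 0)
      else 0 := by
  have h : a - b ∈ X ↔ b - a ∈ X := by rw [← X.neg_mem_iff, neg_sub]
  simp only [Mq_apply, aff_le_aff, dim_aff, Nat.add_right_cancel_iff, h]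
  by_cases h1 : X ≤ Y ∧ dim Y = dim X + 1
  · have h2 : ¬ (dim X = dim Y + 1) := by omega
    by_cases h3 : b - a ∈ Y
    · rw [if_pos ⟨⟨h1.1, h3⟩, h1.2⟩, if_pos h1, if_pos h3]
    · rw [if_neg fun h => h3 h.1.2, if_neg fun h => h2 h.2, if_pos h1, if_neg h3]
  · by_cases h3 : Y ≤ X ∧ dim X = dim Y + 1
    · have h2 : ¬ (dim Y = dim X + 1) := by omega
      rw [if_neg fun h => h2 h.2, if_neg h1, if_pos h3]
      by_cases h4 : b - a ∈ X
      · rw [if_pos ⟨⟨h3.1, h4⟩, h3.2⟩, if_pos h4]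
      · rw [if_neg fun h => h4 h.1.2, if_neg h4]
    · have h1' : ¬ ((X ≤ Y ∧ b - a ∈ Y) ∧ dim Y = dim X + 1) := fun h => h1 ⟨h.1.1, h.2⟩
      have h3' : ¬ ((Y ≤ X ∧ b - a ∈ X) ∧ dim X = dim Y + 1) := fun h => h3 ⟨h.1.1, h.2⟩
      simp only [h1, h3, h1', h3', if_false]

theorem mulVec_embed (v : CB F n) :
    (Mq F (n + 1)).mulVec (embed F n v) = embed F n ((Mq F n).mulVec v) + lam 1 v := by
  refine CB_ext (fun Y => ?_) fun Y a => ?_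
  · rw [Pi.add_apply, embed_up, lam_up, add_zero]
    exact mulVec_push_map incl_injective v Y
  · rw [Matrix.mulVec, dotProduct, embed_eq_push, sum_mul_push, ← embed_eq_push]
    have : ∀ X : Bq F n, Mq F (n + 1) (aff Y a) (X.map (incl F n)) = if X = Y then 1 else 0 :=
      fun X => Mq_aff_up X Y a
    simp [this, isTrivialOn_one, addChar_one]

/-- A factor q arises on both sides of the covering relation. If Y covers X, the coset of Y is q
times larger than that of X, and its character sum forces χ to be trivial on Y. If X covers Y, the
coset size cancels and the entry q^(dim Y + 1) of the larger matrix is q times that of the smaller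
one. -/
theorem sum_Mq_aff_aff {χ : Char F n} {w : CB F n} (X Y : Bq F n) (a : Fin n → F)
    (hX : w X ≠ 0 → IsTrivialOn χ X) :
    ((qq F : ℂ) ^ dim X)⁻¹ * ∑ b, Mq F (n + 1) (aff Y a) (aff X b) * lam χ w (aff X b) =
      if IsTrivialOn χ Y then qq F * (addChar χ (-a) * (Mq F n Y X * w X)) else 0 := by
  by_cases hw : w X = 0
  · simp [hw]
  have hX := hX hw
  have hq := qq_ne_zero (F := F)
  simp only [lam_aff, hX, if_true, Mq_aff_aff]
  rw [Mq_apply]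
  by_cases h1 : X ≤ Y ∧ dim Y = dim X + 1
  · have : ∀ b, (if b - a ∈ Y then (1 : ℂ) else 0) * (addChar χ (-b) * w X) =
        (if b - a ∈ Y then addChar χ (-b) else 0) * w X := by
      intro b; split_ifs <;> simp
    simp only [if_pos h1, this]
    rw [← Finset.sum_mul, sum_addChar_translate, h1.2]
    split_ifs
    · field_simp
      ring
    · simp
  · simp only [if_neg h1]
    by_cases h2 : Y ≤ X ∧ dim X = dim Y + 1
    · have : ∀ b, (if b - a ∈ X then (qq F : ℂ) ^ (dim Y + 1) else 0) * (addChar χ (-b) * w X) =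
          (if b - a ∈ X then addChar χ (-b) else 0) * ((qq F : ℂ) ^ (dim Y + 1) * w X) := by
        intro b; split_ifs <;> ring
      simp only [if_pos h2, this]
      rw [← Finset.sum_mul, sum_addChar_translate, h2.2, if_pos hX, if_pos (hX.mono h2.1)]
      field_simp
      ring
    · simp [if_neg h2]

/-- At `up Y` the sum of χ runs over all of F^n and survives only for χ = 1. The support condition
is needed because λ(χ) forgets the other values of w while M w still depends on them. -/
theorem mulVec_lam {χ : Char F n} {w : CB F n} (hw : ∀ X, w X ≠ 0 → IsTrivialOn χ X) :
    (Mq F (n + 1)).mulVec (lam χ w) =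
      (qq F : ℂ) • lam χ ((Mq F n).mulVec w) +
        (if χ = 1 then (qq F : ℂ) ^ n else 0) • embed F n w := by
  refine CB_ext (fun Y => ?_) fun Y a => ?_
  · rw [Matrix.mulVec, dotProduct, sum_Bq_succ]
    simp only [lam_up, mul_zero, Finset.sum_const_zero, zero_add, Pi.add_apply, Pi.smul_apply,
      smul_eq_mul, embed_up, Mq_up_aff]
    rw [Finset.sum_eq_single Y]
    · by_cases h : w Y = 0
      · simp [h]
      · have h1 : ∑ b, addChar χ (-b) = if χ = 1 then (qq F : ℂ) ^ n else 0 := by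
          rw [← sum_addChar, ← Equiv.sum_comp (Equiv.neg (Fin n → F))]
          simp
        simp only [if_true, lam_aff, if_pos (hw Y h)]
        rw [← Finset.mul_sum, ← Finset.sum_mul, h1,
          inv_mul_cancel_left₀ (pow_ne_zero _ qq_ne_zero)]
    · intro X _ hX
      simp [hX]
    · simp
  · rw [Matrix.mulVec, dotProduct, sum_Bq_succ]
    simp only [lam_up, mul_zero, Finset.sum_const_zero, zero_add, sum_Mq_aff_aff _ Y a (hw _)]
    simp only [Pi.add_apply, Pi.smul_apply, embed_aff, lam_aff, smul_eq_mul]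
    by_cases h : IsTrivialOn χ Y
    · simp only [h, if_true, mul_zero, add_zero]
      rw [Matrix.mulVec, dotProduct, Finset.mul_sum, Finset.mul_sum]
    · simp [h]

/-- Applying M may leave the subspaces of the image of f, but λ(χ) discards those values; on the
image, M is the transported smaller matrix. -/
theorem lam_mulVec_push {χ : Char F m} {f : (Fin n → F) →ₗ[F] (Fin m → F)}
    (hf : Function.Injective f) (hχ : ∀ Y, IsTrivialOn χ Y → Y ≤ LinearMap.range f)
    (v : CB F n) :
    lam χ ((Mq F m).mulVec (push f v)) = lam χ (push f ((Mq F n).mulVec v)) := by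
  refine CB_ext (fun Y => by simp) fun Y a => ?_
  rw [lam_aff, lam_aff]
  split_ifs with h
  · rw [← Submodule.map_comap_eq_of_le (hχ Y h), mulVec_push_map hf, push_map hf]
  · rfl

/-! ### The inner product -/

theorem piWeight_map {f : (Fin n → F) →ₗ[F] (Fin (n + 1) → F)} (hf : Function.Injective f)
    (Y : Bq F n) : piWeight (Y.map f) = (1 + (qq F : ℝ) ^ n)⁻¹ * piWeight Y := by
  rw [piWeight, piWeight, dim_map_of_injective hf, Finset.prod_range_succ, div_eq_mul_inv,
    mul_inv]
  ring

/-- The factor q^(dim Y), from C(d+1, 2) = d + C(d, 2), is what cancels the inverse power in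
`sum_Bq_succ`. -/
theorem piWeight_aff (Y : Bq F n) (a : Fin n → F) :
    piWeight (aff Y a) = (1 + (qq F : ℝ) ^ n)⁻¹ * ((qq F : ℝ) ^ dim Y * piWeight Y) := by
  rw [piWeight, piWeight, dim_aff, Finset.prod_range_succ, Nat.choose_succ_succ',
    Nat.choose_one_right, pow_add, div_eq_mul_inv, mul_inv]
  ring

theorem piWeight_pos (Y : Bq F n) : 0 < piWeight Y := by
  have : 0 < (qq F : ℝ) := Nat.cast_pos.2 Fintype.card_pos
  rw [piWeight]
  positivity

theorem piInner_self_ne_zero {v : CB F n} (hv : v ≠ 0) : piInner v v ≠ 0 := by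
  have h : piInner v v = ((∑ X, Complex.normSq (v X) * piWeight X : ℝ) : ℂ) := by
    rw [piInner]
    push_cast
    exact Finset.sum_congr rfl fun X _ => by rw [Complex.normSq_eq_conj_mul_self]
  obtain ⟨X, hX⟩ := Function.ne_iff.1 hv
  rw [h, Complex.ofReal_ne_zero]
  refine (Finset.sum_pos' (fun Y _ => mul_nonneg (Complex.normSq_nonneg _) (piWeight_pos Y).le)
    ⟨X, Finset.mem_univ _, mul_pos (Complex.normSq_pos.2 hX) (piWeight_pos X)⟩).ne'

theorem piInner_add_left (u v w : CB F n) : piInner (u + v) w = piInner u w + piInner v w := by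
  simp [piInner, add_mul, Finset.sum_add_distrib]

theorem piInner_add_right (u v w : CB F n) : piInner u (v + w) = piInner u v + piInner u w := by
  simp [piInner, mul_add, add_mul, Finset.sum_add_distrib]

theorem piInner_smul_left (c : ℂ) (u v : CB F n) :
    piInner (c • u) v = starRingEnd ℂ c * piInner u v := by
  simp [piInner, Finset.mul_sum, mul_assoc]

theorem piInner_smul_right (c : ℂ) (u v : CB F n) : piInner u (c • v) = c * piInner u v := by
  simp only [piInner, Finset.mul_sum, Pi.smul_apply, smul_eq_mul]
  exact Finset.sum_congr rfl fun X _ => by ring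

theorem piInner_conj (u v : CB F n) : starRingEnd ℂ (piInner u v) = piInner v u := by
  simp only [piInner, map_sum, map_mul, Complex.conj_conj, Complex.conj_ofReal]
  exact Finset.sum_congr rfl fun X _ => by ring

theorem piInner_push {f : (Fin n → F) →ₗ[F] (Fin (n + 1) → F)} (hf : Function.Injective f)
    (u v : CB F n) :
    piInner (push f u) (push f v) = (1 + (qq F : ℂ) ^ n)⁻¹ * piInner u v := by
  have h : piInner (push f u) (push f v) =
      ∑ Z, (starRingEnd ℂ (push f u Z) * (piWeight Z : ℂ)) * push f v Z :=
    Finset.sum_congr rfl fun X _ => by ring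
  rw [h, sum_mul_push, piInner, Finset.mul_sum]
  refine Finset.sum_congr rfl fun X _ => ?_
  rw [push_map hf, piWeight_map hf]
  push_cast
  ring

theorem piInner_embed_lam (χ : Char F n) (u v : CB F n) :
    piInner (embed F n u) (lam χ v) = 0 := by
  rw [piInner, sum_Bq_succ]
  simp

theorem sum_conj_addChar_mul (χ ψ : Char F n) :
    ∑ a, starRingEnd ℂ (addChar χ (-a)) * addChar ψ (-a) =
      if χ = ψ then (qq F : ℂ) ^ n else 0 := by
  have h : ∀ a, starRingEnd ℂ (addChar χ (-a)) * addChar ψ (-a) =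
      (addChar χ - addChar ψ) a := by
    intro a
    rw [conj_addChar, neg_neg, AddChar.sub_apply]
  simp_rw [h, AddChar.sum_eq_ite, sub_eq_zero, addChar_bijective.1.eq_iff]
  simp

theorem piInner_lam_lam_of_ne {χ ψ : Char F n} (h : χ ≠ ψ) (u v : CB F n) :
    piInner (lam χ u) (lam ψ v) = 0 := by
  rw [piInner, sum_Bq_succ]
  simp only [lam_up, mul_zero, zero_mul, Finset.sum_const_zero, zero_add]
  refine Finset.sum_eq_zero fun Y _ => ?_
  simp only [lam_aff, piWeight_aff]
  by_cases h1 : IsTrivialOn χ Y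
  · by_cases h2 : IsTrivialOn ψ Y
    · simp only [h1, h2, if_true, map_mul]
      have := sum_conj_addChar_mul χ ψ
      rw [if_neg h] at this
      set c : ℂ := (((1 + (qq F : ℝ) ^ n)⁻¹ * ((qq F : ℝ) ^ dim Y * piWeight Y) : ℝ) : ℂ)
      have h3 : ∀ a, starRingEnd ℂ (addChar χ (-a)) * starRingEnd ℂ (u Y) *
          (addChar ψ (-a) * v Y) * c = starRingEnd ℂ (addChar χ (-a)) * addChar ψ (-a) *
            (starRingEnd ℂ (u Y) * v Y * c) := fun a => by ring
      simp_rw [h3]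
      rw [← Finset.sum_mul, this]
      simp
    · simp [h2]
  · simp [h1]

theorem piInner_lam_lam {χ : Char F n} {u : CB F n} (hu : ∀ X, u X ≠ 0 → IsTrivialOn χ X)
    (v : CB F n) :
    piInner (lam χ u) (lam χ v) =
      (qq F : ℂ) ^ n * (1 + (qq F : ℂ) ^ n)⁻¹ * piInner u v := by
  rw [piInner, sum_Bq_succ, piInner, Finset.mul_sum]
  simp only [lam_up, mul_zero, zero_mul, Finset.sum_const_zero, zero_add]
  refine Finset.sum_congr rfl fun Y _ => ?_
  by_cases h : u Y = 0
  · simp [h]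
  simp only [lam_aff, piWeight_aff, if_pos (hu Y h), map_mul]
  have := sum_conj_addChar_mul χ χ
  rw [if_pos rfl] at this
  have hq := qq_ne_zero (F := F)
  set c : ℂ := (((1 + (qq F : ℝ) ^ n)⁻¹ * ((qq F : ℝ) ^ dim Y * piWeight Y) : ℝ) : ℂ) with hc
  have h3 : ∀ a, starRingEnd ℂ (addChar χ (-a)) * starRingEnd ℂ (u Y) *
      (addChar χ (-a) * v Y) * c = starRingEnd ℂ (addChar χ (-a)) * addChar χ (-a) *
        (starRingEnd ℂ (u Y) * v Y * c) := fun a => by ring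
  simp_rw [h3]
  rw [← Finset.sum_mul, this, hc]
  push_cast
  have : ((qq F : ℂ) ^ dim Y)⁻¹ * (qq F : ℂ) ^ dim Y = 1 := inv_mul_cancel₀ (pow_ne_zero _ hq)
  linear_combination ((qq F : ℂ) ^ n * (1 + (qq F : ℂ) ^ n)⁻¹ * starRingEnd ℂ (u Y) * v Y *
    (piWeight Y : ℂ)) * this

end QCube

namespace QCube

open scoped Classical

variable {F : Type u} [Field F] {n k : ℕ}

/-! ### Schubert normal form -/

theorem aff_eq_sup (Y : Bq F n) (a : Fin n → F) :
    aff Y a = up Y ⊔ Submodule.span F {Fin.snoc (α := fun _ => F) a 1} := by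
  refine le_antisymm ?_ (sup_le (up_le_aff.2 le_rfl) ?_)
  · refine forall_snoc.2 fun x c hx => ?_
    have : (Fin.snoc (α := fun _ => F) x c : Fin (n + 1) → F) =
        Fin.snoc (α := fun _ => F) (x - c • a) 0 + c • Fin.snoc (α := fun _ => F) a 1 := by
      ext i
      refine Fin.lastCases ?_ (fun j => ?_) i <;> simp
    rw [this]
    exact Submodule.add_mem_sup (mem_up.2 ⟨rfl, mem_aff.1 hx⟩)
      (Submodule.smul_mem _ _ (Submodule.mem_span_singleton_self _))
  · rw [Submodule.span_singleton_le_iff_mem]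
    exact snoc_one_mem_aff Y a

/-- The coefficients of a combination of columns can be read off in the pivot rows; injectivity and
uniqueness rest on this. -/
theorem mulVec_pivot {M : Matrix (Fin n) (Fin k) F} {r : Fin k → Fin n}
    (h : M.submatrix r id = 1) (c : Fin k → F) (j : Fin k) : M.mulVec c (r j) = c j := by
  have : (M.submatrix r id).mulVec c j = M.mulVec c (r j) := rfl
  rw [← this, h, Matrix.one_mulVec]

theorem IsSchubert.injective {M : Matrix (Fin n) (Fin k) F} (h : IsSchubert M) :
    Function.Injective (Matrix.mulVecLin M) := by
  obtain ⟨r, -, -, h⟩ := h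
  intro c d hcd
  ext j
  rw [← mulVec_pivot h c, ← mulVec_pivot h d]
  exact congrFun hcd (r j)

theorem IsSchubertFormOf.range_eq {X : Bq F n} {M : Matrix (Fin n) (Fin k) F}
    (h : IsSchubertFormOf X M) : LinearMap.range (Matrix.mulVecLin M) = X := by
  rw [Matrix.range_mulVecLin, h.2]

theorem IsSchubertFormOf.dim_eq {X : Bq F n} {M : Matrix (Fin n) (Fin k) F}
    (h : IsSchubertFormOf X M) : dim X = k := by
  have := LinearMap.finrank_range_of_inj h.1.injective
  rw [h.range_eq] at this
  simpa using this

theorem exists_isSchubertFormOf_up {Y : Bq F n} {M : Matrix (Fin n) (Fin k) F}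
    (h : IsSchubertFormOf Y M) :
    ∃ M : Matrix (Fin (n + 1)) (Fin k) F, IsSchubertFormOf (up Y) M := by
  obtain ⟨⟨r, hr, h0, h1⟩, hspan⟩ := h
  refine ⟨Matrix.of fun i j => incl F n (M.col j) i,
    ⟨Fin.castSucc ∘ r, Fin.strictMono_castSucc.comp hr, fun j i => ?_, ?_⟩, ?_⟩
  · refine Fin.lastCases ?_ (fun i => ?_) i
    · simp [incl_apply]
    · intro hi
      simpa [incl_apply] using h0 j i (by simpa using hi)
  · rw [← h1]
    ext i j
    simp [incl_apply]
  · rw [up, ← hspan, Submodule.map_span, ← Set.range_comp]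
    rfl

theorem exists_isSchubertFormOf_aff {Y : Bq F n} {M : Matrix (Fin n) (Fin k) F}
    (h : IsSchubertFormOf Y M) (a : Fin n → F) :
    ∃ M : Matrix (Fin (n + 1)) (Fin (k + 1)) F, IsSchubertFormOf (aff Y a) M := by
  have hrange := h.range_eq
  obtain ⟨⟨r, hr, h0, h1⟩, hspan⟩ := h
  -- The new column (a, 1) must vanish in the old pivot rows, so an element of Y is subtracted from
  -- a; this stays in the same coset.
  obtain ⟨b, hb, hba⟩ : ∃ b : Fin n → F, (∀ j, b (r j) = 0) ∧ aff Y a = aff Y b := by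
    refine ⟨a - M.mulVec (a ∘ r), fun j => ?_, aff_eq_aff.2 ⟨rfl, ?_⟩⟩
    · simp [mulVec_pivot h1]
    · rw [sub_sub_cancel, ← hrange]
      exact ⟨a ∘ r, rfl⟩
  let col : Fin (k + 1) → Fin (n + 1) → F :=
    Fin.snoc (α := fun _ => Fin (n + 1) → F) (fun j => incl F n (M.col j))
      (Fin.snoc (α := fun _ => F) b 1)
  let s : Fin (k + 1) → Fin (n + 1) :=
    Fin.snoc (α := fun _ => Fin (n + 1)) (Fin.castSucc ∘ r) (Fin.last n)
  refine ⟨Matrix.of fun i j => col j i, ⟨s, ?_, fun j => ?_, ?_⟩, ?_⟩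
  · intro i j
    refine Fin.lastCases ?_ (fun j => ?_) j
    · refine Fin.lastCases (by simp) (fun i => ?_) i
      simp [s, Fin.castSucc_lt_last]
    · refine Fin.lastCases (fun h => absurd h (Fin.castSucc_lt_last j).asymm) (fun i h => ?_) i
      simpa [s] using hr (by simpa using h)
  · refine Fin.lastCases (fun i hi => ?_) (fun j i => ?_) j
    · simp only [s, Fin.snoc_last] at hi
      exact absurd hi (Fin.le_last i).not_gt
    · refine Fin.lastCases ?_ (fun i => ?_) i
      · simp [col, incl_apply]
      · intro hi
        simpa [col, incl_apply] using h0 j i (by simpa [s] using hi)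
  · ext i j
    have h1' : ∀ i j, M (r i) j = (1 : Matrix (Fin k) (Fin k) F) i j := fun i j => by
      rw [← h1]; rfl
    refine Fin.lastCases ?_ (fun i => ?_) i
    · refine Fin.lastCases ?_ (fun j => ?_) j
      · simp [s, col]
      · simp [s, col, incl_apply, (Fin.castSucc_lt_last j).ne']
    · refine Fin.lastCases ?_ (fun j => ?_) j
      · simp [s, col, hb, (Fin.castSucc_lt_last i).ne]
      · simp [s, col, incl_apply, h1', Matrix.one_apply]
  · rw [hba, aff_eq_sup, up, ← hspan, Submodule.map_span, ← Submodule.span_union,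
      ← Set.range_comp]
    have hlast : (Matrix.of fun i j => col j i).col (Fin.last k) =
        Fin.snoc (α := fun _ => F) b 1 := by
      ext i; simp [col]
    have hcast : ∀ j, (Matrix.of fun i j => col j i).col j.castSucc = (incl F n ∘ M.col) j := by
      intro j; ext i; simp [col]
    congr 1
    ext z
    constructor
    · rintro ⟨j, rfl⟩
      refine Fin.lastCases ?_ (fun j => ?_) j
      · right
        rw [Set.mem_singleton_iff]
        exact hlast
      · left
        exact ⟨j, (hcast j).symm⟩
    · rintro (⟨j, rfl⟩ | rfl)
      · exact ⟨j.castSucc, hcast j⟩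
      · exact ⟨Fin.last k, hlast⟩

theorem exists_isSchubertFormOf : ∀ {n : ℕ} (X : Bq F n),
    ∃ (k : ℕ) (M : Matrix (Fin n) (Fin k) F), IsSchubertFormOf X M
  | 0, X => ⟨0, 0, ⟨Fin.elim0, fun i => i.elim0, fun i => i.elim0, by ext i; exact i.elim0⟩,
      Subsingleton.elim _ _⟩
  | n + 1, X => by
    rcases up_or_aff X with ⟨Y, rfl⟩ | ⟨Y, a, rfl⟩
    · obtain ⟨k, M, hM⟩ := exists_isSchubertFormOf Y
      exact ⟨k, exists_isSchubertFormOf_up hM⟩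
    · obtain ⟨k, M, hM⟩ := exists_isSchubertFormOf Y
      exact ⟨k + 1, exists_isSchubertFormOf_aff hM a⟩

theorem exists_isSchubertFormOf_of_dim {X : Bq F n} (hX : dim X = k) :
    ∃ M : Matrix (Fin n) (Fin k) F, IsSchubertFormOf X M := by
  obtain ⟨l, M, hM⟩ := exists_isSchubertFormOf X
  obtain rfl : l = k := hM.dim_eq.symm.trans hX
  exact ⟨M, hM⟩

/-- The pivot rows are the positions of the last nonzero entries of vectors of X, so they depend on
X alone. -/
theorem mem_range_pivot {X : Bq F n} {M : Matrix (Fin n) (Fin k) F} {r : Fin k → Fin n}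
    (hr : StrictMono r) (h0 : ∀ j i, r j < i → M i j = 0) (h1 : M.submatrix r id = 1)
    (hX : LinearMap.range (Matrix.mulVecLin M) = X) (i : Fin n) :
    i ∈ Set.range r ↔ ∃ x ∈ X, x i ≠ 0 ∧ ∀ i', i < i' → x i' = 0 := by
  subst hX
  constructor
  · rintro ⟨j, rfl⟩
    refine ⟨_, ⟨Pi.single j 1, rfl⟩, ?_, fun i' hi' => ?_⟩
    · simp [mulVec_pivot h1]
    · simpa using h0 j i' hi'
  · rintro ⟨_, ⟨c, rfl⟩, hi, hi'⟩
    simp only [Matrix.mulVecLin_apply] at hi hi'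
    have hne : (Finset.univ.filter fun j => c j ≠ 0).Nonempty := by
      rw [Finset.filter_nonempty_iff]
      by_contra! hc
      have : c = 0 := funext fun j => hc j (Finset.mem_univ j)
      simp [this] at hi
    -- For the last column j with nonzero coefficient, the combination has its last nonzero entry in
    -- row `r j`.
    obtain ⟨j, hj, hmax⟩ := Finset.exists_max_image _ id hne
    have hj := (Finset.mem_filter.1 hj).2
    refine ⟨j, ?_⟩
    rcases lt_trichotomy i (r j) with hlt | heq | hgt
    · exact absurd ((mulVec_pivot h1 c j).symm.trans (hi' _ hlt)) hj
    · exact heq.symm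
    · refine absurd ?_ hi
      rw [Matrix.mulVec, dotProduct]
      refine Finset.sum_eq_zero fun l _ => ?_
      by_cases hl : c l = 0
      · simp [hl]
      · have : l ≤ j := hmax l (by simpa using hl)
        rw [h0 l i ((hr.monotone this).trans_lt hgt), zero_mul]

theorem IsSchubertFormOf.unique {X : Bq F n} {M N : Matrix (Fin n) (Fin k) F}
    (hM : IsSchubertFormOf X M) (hN : IsSchubertFormOf X N) : M = N := by
  have hMX := hM.range_eq
  have hNX := hN.range_eq
  obtain ⟨⟨r, hr, hr0, hr1⟩, -⟩ := hM
  obtain ⟨⟨s, hs, hs0, hs1⟩, -⟩ := hN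
  obtain rfl : r = s := by
    rw [← StrictMono.range_inj hr hs]
    ext i
    rw [mem_range_pivot hr hr0 hr1 hMX, mem_range_pivot hs hs0 hs1 hNX]
  ext i j
  -- Column j of N is a combination of the columns of M; the common pivot rows show that the
  -- coefficients are those of column j of M.
  have hj : N.mulVec (Pi.single j 1) ∈ LinearMap.range (Matrix.mulVecLin M) := by
    rw [hMX, ← hNX]
    exact ⟨_, rfl⟩
  obtain ⟨c, hc⟩ := hj
  rw [Matrix.mulVecLin_apply] at hc
  have : c = Pi.single j 1 := by
    ext l
    rw [← mulVec_pivot hr1 c l, hc, mulVec_pivot hs1]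
  rw [this] at hc
  simpa using congrFun hc i

theorem schubertForm_spec {X : Bq F n} (hX : dim X = k) :
    IsSchubertFormOf X (schubertForm k X) :=
  Classical.epsilon_spec (exists_isSchubertFormOf_of_dim hX)

theorem tau_injective {X : Bq F (n + 1)} (hX : dim X = n) : Function.Injective (tau X) :=
  (schubertForm_spec hX).1.injective

theorem range_tau {X : Bq F (n + 1)} (hX : dim X = n) : LinearMap.range (tau X) = X :=
  (schubertForm_spec hX).range_eq

/-! ### The hyperplane of a nontrivial character -/

/-- The map c ↦ e(c ·) from F to its dual is injective, and both have q elements. -/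
theorem exists_mulShift [Fintype F] {e : AddChar F ℂ} (he : e ≠ 1) (ψ : AddChar F ℂ) :
    ∃ c, ∀ x, ψ x = e (c * x) := by
  have hinj := AddChar.to_mulShift_inj_of_isPrimitive (AddChar.IsPrimitive.of_ne_one he)
  have hbij : Function.Bijective e.mulShift :=
    (Fintype.bijective_iff_injective_and_card _).2 ⟨hinj, AddChar.card_eq.symm⟩
  obtain ⟨c, rfl⟩ := hbij.2 ψ
  exact ⟨c, fun x => AddChar.mulShift_apply⟩

/-- The largest subspace on which the character `χ` is trivial. -/
def kernel (χ : Char F n) : Bq F n where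
  -- All scalars are required, since the group kernel of χ need not be closed under multiplication
  -- by F.
  carrier := {a | ∀ c : F, addChar χ (c • a) = 1}
  add_mem' := fun {a b} ha hb c => by
    rw [smul_add, AddChar.map_add_eq_mul, ha c, hb c, one_mul]
  zero_mem' := fun c => by simp
  smul_mem' := fun d a ha c => by rw [smul_smul]; exact ha _

theorem isTrivialOn_iff_le_kernel {χ : Char F n} {Y : Bq F n} :
    IsTrivialOn χ Y ↔ Y ≤ kernel χ :=
  ⟨fun h y hy c => h _ (Y.smul_mem c hy), fun h y hy => by simpa using h hy 1⟩

variable [Fintype F]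

theorem dim_kernel {χ : Char F n} (hχ : χ ≠ 1) : dim (kernel χ) + 1 = n := by
  obtain ⟨a, ha⟩ : ∃ a, addChar χ a ≠ 1 := by
    rw [← AddChar.ne_zero_iff]
    exact fun h => hχ (addChar_eq_zero.1 h)
  let line (b : Fin n → F) : AddChar F ℂ :=
    (addChar χ).compAddMonoidHom (LinearMap.toSpanSingleton F (Fin n → F) b).toAddMonoidHom
  have hline : ∀ b c, line b c = addChar χ (c • b) := fun b c => rfl
  have hne : line a ≠ 1 := by
    intro h
    refine ha ?_
    have := DFunLike.congr_fun h (1 : F)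
    simpa [hline] using this
  have hsup : kernel χ ⊔ Submodule.span F {a} = ⊤ := by
    refine eq_top_iff.2 fun b _ => ?_
    -- On the line through b the character is the one on the line through a, rescaled by c; hence b
    -- - c a lies in `kernel χ`, and a spans a complement.
    obtain ⟨c, hc⟩ := exists_mulShift hne (line b)
    rw [← sub_add_cancel b (c • a)]
    refine Submodule.add_mem_sup (fun d => ?_)
      (Submodule.smul_mem _ _ (Submodule.mem_span_singleton_self _))
    rw [smul_sub, sub_eq_add_neg, AddChar.map_add_eq_mul, AddChar.map_neg_eq_inv, smul_smul,
      ← hline, ← hline, hc, mul_comm d c, mul_inv_cancel₀]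
    exact Units.ne_zero _
  have hna : a ∉ kernel χ := fun h => ha (by simpa using h 1)
  have hdisj : kernel χ ⊓ Submodule.span F {a} = ⊥ := by
    rw [← disjoint_iff, Submodule.disjoint_span_singleton]
    exact fun h => absurd h hna
  have h := Submodule.finrank_sup_add_finrank_inf_eq (kernel χ) (Submodule.span F {a})
  rw [hsup, hdisj, finrank_top, finrank_bot, finrank_span_singleton] at h
  · simpa using h.symm
  · rintro rfl
    exact hna (zero_mem _)

theorem p_ket_hat_ne_zero {χ : Char F n} {X : Bq F n} :
    p χ (ket (hat X)) ≠ 0 ↔ IsTrivialOn χ X := by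
  constructor
  · intro h
    by_contra hX
    exact h (CB_ext (fun Y => p_ket_hat_up χ Y X) fun Y a => by simp [p_ket_hat_aff, hX])
  · intro hX h
    have := congrFun h (aff X 0)
    rw [p_ket_hat_aff, if_pos ⟨rfl, hX⟩] at this
    simp at this

theorem isHyperplaneOf_iff {χ : Char F n} (hχ : χ ≠ 1) {X : Bq F n} :
    IsHyperplaneOf χ X ↔ X = kernel χ := by
  rw [IsHyperplaneOf, p_ket_hat_ne_zero, isTrivialOn_iff_le_kernel]
  have := dim_kernel hχ
  constructor
  · rintro ⟨h1, h2⟩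
    exact Submodule.eq_of_le_of_finrank_eq h2 (Nat.add_right_cancel (h1.trans this.symm))
  · rintro rfl
    exact ⟨this, le_rfl⟩

theorem hyperplane_eq_kernel {χ : Char F n} (hχ : χ ≠ 1) : hyperplane χ = kernel χ :=
  (isHyperplaneOf_iff hχ).1
    (Classical.epsilon_spec (p := IsHyperplaneOf χ) ⟨kernel χ, (isHyperplaneOf_iff hχ).2 rfl⟩)

end QCube

namespace QCube

open scoped Classical

variable {F : Type u} [Field F] {n k : ℕ}

theorem SeqE.N_le : ∀ {n : ℕ} (α : SeqE F n), α.N ≤ n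
  | _, .nil => le_rfl
  | _, .zero β => β.N_le.trans (Nat.le_succ _)
  | _, .one β => Nat.succ_le_succ β.N_le
  | _, .char β _ _ => Nat.succ_le_succ (β.N_le.trans (Nat.le_succ _))

variable [Fintype F]

/-! ### The number of subspaces -/

theorem qBinom_eq_sum (n k : ℕ) :
    (qBinom F n k : ℂ) = ∑ X : Bq F n, if dim X = k then 1 else 0 := by
  rw [qBinom, Nat.card_eq_fintype_card, Fintype.card_subtype, Finset.sum_boole]

theorem qBinom_zero (k : ℕ) : (qBinom F 0 k : ℂ) = if k = 0 then 1 else 0 := by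
  have : ∀ X : Bq F 0, dim X = 0 := fun X => Module.finrank_zero_of_subsingleton
  simp [qBinom_eq_sum, this, eq_comm]

/-- A k-dimensional X yields q^n / q^k different `aff X a`. The quotient in ℂ avoids truncated
subtraction when k > n, where the count is 0. -/
theorem qBinom_succ_succ (n k : ℕ) :
    (qBinom F (n + 1) (k + 1) : ℂ) =
      qBinom F n (k + 1) + (qq F : ℂ) ^ n / (qq F : ℂ) ^ k * qBinom F n k := by
  rw [qBinom_eq_sum, sum_Bq_succ, qBinom_eq_sum, qBinom_eq_sum, Finset.mul_sum]
  congr 1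
  · simp
  · refine Finset.sum_congr rfl fun X _ => ?_
    by_cases h : dim X = k
    · simp [h, div_eq_inv_mul]
    · simp [h]

theorem qBinom_zero_right (n : ℕ) : (qBinom F n 0 : ℂ) = 1 := by
  simp [qBinom_eq_sum]

/-- The ratio of neighbouring q-binomials, cross-multiplied so that it also holds for k ≥ n.
Pascal's rule reduces it to the induction hypotheses at k and k + 1. -/
theorem qBinom_right_succ (n k : ℕ) :
    ((qq F : ℂ) ^ (k + 1) - 1) * qBinom F n (k + 1) =
      ((qq F : ℂ) ^ n / (qq F : ℂ) ^ k - 1) * qBinom F n k := by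
  have hq := qq_ne_zero (F := F)
  induction n generalizing k with
  | zero => cases k <;> simp [qBinom_zero]
  | succ n ih =>
    cases k with
    | zero =>
      have := ih 0
      rw [qBinom_succ_succ]
      simp only [qBinom_zero_right] at *
      linear_combination this
    | succ k =>
      have h1 := ih (k + 1)
      have h2 := ih k
      have h3 : (qq F : ℂ) ^ (n + 1) / (qq F : ℂ) ^ (k + 1) = (qq F : ℂ) ^ n / (qq F : ℂ) ^ k := by
        field_simp; ring
      have h4 : (qq F : ℂ) ^ (k + 1) * ((qq F : ℂ) ^ n / (qq F : ℂ) ^ (k + 1)) =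
          (qq F : ℂ) ^ n := by field_simp
      have h5 : (qq F : ℂ) ^ (k + 1) * ((qq F : ℂ) ^ n / (qq F : ℂ) ^ k) =
          (qq F : ℂ) ^ (n + 1) := by field_simp; ring
      rw [qBinom_succ_succ, qBinom_succ_succ, h3]
      rw [pow_succ _ (k + 1)] at *
      set A := (qq F : ℂ) ^ n / (qq F : ℂ) ^ k
      set B := (qq F : ℂ) ^ n / (qq F : ℂ) ^ (k + 1)
      set C := (qq F : ℂ) ^ (k + 1)
      rw [pow_succ, ← h4] at h5
      linear_combination h1 + A * h2 - (qBinom F n (k + 1) : ℂ) * h5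

theorem qBinom_succ_left (n k : ℕ) :
    ((qq F : ℂ) ^ (n + 1) / (qq F : ℂ) ^ k - 1) * qBinom F (n + 1) k =
      ((qq F : ℂ) ^ (n + 1) - 1) * qBinom F n k := by
  have hq := qq_ne_zero (F := F)
  cases k with
  | zero => simp [qBinom_zero_right]
  | succ k =>
    have h2 := qBinom_right_succ (F := F) n k
    have h3 : (qq F : ℂ) ^ (n + 1) / (qq F : ℂ) ^ (k + 1) = (qq F : ℂ) ^ n / (qq F : ℂ) ^ k := by
      field_simp; ring
    have h5 : (qq F : ℂ) ^ (k + 1) * ((qq F : ℂ) ^ n / (qq F : ℂ) ^ k) =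
        (qq F : ℂ) ^ (n + 1) := by field_simp; ring
    rw [qBinom_succ_succ, h3, ← h5]
    linear_combination -((qq F : ℂ) ^ n / (qq F : ℂ) ^ k) * h2

/-- The recurrence of Goldman and Rota, refined by dimension. -/
theorem qBinom_add_two (n k : ℕ) :
    (qBinom F (n + 2) (k + 1) : ℂ) =
      qBinom F (n + 1) (k + 1) + qBinom F (n + 1) k +
        ((qq F : ℂ) ^ (n + 1) - 1) * qBinom F n k := by
  -- One copy of the second term is split off; `qBinom_succ_left` turns the remaining coefficient
  -- q^(n+1)/q^k - 1 into a count in dimension n.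
  rw [qBinom_succ_succ]
  linear_combination qBinom_succ_left (F := F) n k

theorem card_Bq (n : ℕ) : Fintype.card (Bq F n) = galoisNumber F n := by
  rw [← Finset.card_univ, Finset.card_eq_sum_card_fiberwise
    (f := fun X : Bq F n => dim X) (t := Finset.range (n + 1))]
  · refine Finset.sum_congr rfl fun k _ => ?_
    rw [qBinom, Nat.card_eq_fintype_card, Fintype.card_subtype]
  · intro X _
    have := Submodule.finrank_le X
    rw [Module.finrank_fin_fun] at this
    simpa [Nat.lt_succ_iff] using this

/-! ### The number of sequences -/

instance finite_char : Finite (Char F n) := Finite.of_injective _ addChar_bijective.1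

noncomputable instance fintype_char : Fintype (Char F n) := Fintype.ofFinite _

theorem card_char : Fintype.card (Char F n) = qq F ^ n := by
  rw [Fintype.card_of_bijective addChar_bijective, AddChar.card_eq]
  simp

theorem card_nontrivial_char :
    (Fintype.card {χ : Char F n // χ ≠ 1} : ℂ) = (qq F : ℂ) ^ n - 1 := by
  have h : Fintype.card {χ : Char F n // χ ≠ 1} + 1 = qq F ^ n := by
    rw [← card_char, Fintype.card_subtype_compl, Fintype.card_subtype_eq]
    exact Nat.sub_add_cancel Fintype.card_pos
  rw [eq_sub_iff_add_eq]
  exact_mod_cast h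

/-- The sequences of length `0`. -/
def SeqE.equivZero : SeqE F 0 ≃ Unit where
  toFun _ := ()
  invFun _ := .nil
  left_inv α := by cases α; rfl
  right_inv _ := rfl

/-- The sequences of length `1`. -/
def SeqE.equivOne : SeqE F 1 ≃ SeqE F 0 ⊕ SeqE F 0 where
  toFun
    | .zero β => .inl β
    | .one β => .inr β
  invFun := Sum.elim .zero .one
  left_inv α := by cases α <;> rfl
  right_inv x := by rcases x with β | β <;> rfl

/-- The sequences of length `n + 2`, by their last entry. -/
def SeqE.equivAddTwo (n : ℕ) : SeqE F (n + 2) ≃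
    (SeqE F (n + 1) ⊕ SeqE F (n + 1)) ⊕ SeqE F n × {χ : Char F (n + 1) // χ ≠ 1} where
  toFun
    | .zero β => .inl (.inl β)
    | .one β => .inl (.inr β)
    | .char β χ hχ => .inr (β, ⟨χ, hχ⟩)
  invFun := Sum.elim (Sum.elim .zero .one) fun x => .char x.1 x.2.1 x.2.2
  left_inv α := by cases α <;> rfl
  right_inv x := by rcases x with (β | β) | x <;> rfl

theorem SeqE.finite : ∀ n : ℕ, Finite (SeqE F n)
  | 0 => Finite.of_equiv _ SeqE.equivZero.symm
  | 1 =>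
    have := SeqE.finite 0
    Finite.of_equiv _ SeqE.equivOne.symm
  | n + 2 =>
    have := SeqE.finite n
    have := SeqE.finite (n + 1)
    Finite.of_equiv _ (SeqE.equivAddTwo n).symm

noncomputable instance SeqE.fintype (n : ℕ) : Fintype (SeqE F n) :=
  have := SeqE.finite (F := F) n
  Fintype.ofFinite _

theorem sum_SeqE_add_two (n k : ℕ) :
    (∑ α : SeqE F (n + 2), if α.N = k then 1 else 0 : ℂ) =
      (∑ β : SeqE F (n + 1), if β.N = k then 1 else 0) +
        (∑ β : SeqE F (n + 1), if β.N + 1 = k then 1 else 0) +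
        ((qq F : ℂ) ^ (n + 1) - 1) * ∑ β : SeqE F n, if β.N + 1 = k then 1 else 0 := by
  rw [← Equiv.sum_comp (SeqE.equivAddTwo n).symm, Fintype.sum_sum_type, Fintype.sum_sum_type,
    Fintype.sum_prod_type, Finset.mul_sum]
  congr 1
  refine Finset.sum_congr rfl fun β _ => ?_
  rw [← card_nontrivial_char]
  simp [SeqE.equivAddTwo, SeqE.N]

theorem sum_SeqE_zero (k : ℕ) :
    (∑ α : SeqE F 0, if α.N = k then 1 else 0 : ℂ) = qBinom F 0 k := by
  rw [← Equiv.sum_comp SeqE.equivZero.symm, qBinom_zero]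
  simp [SeqE.equivZero, SeqE.N, eq_comm]

theorem sum_SeqE_one (k : ℕ) :
    (∑ α : SeqE F 1, if α.N = k then 1 else 0 : ℂ) = qBinom F 1 k := by
  rw [← Equiv.sum_comp SeqE.equivOne.symm, Fintype.sum_sum_type]
  simp only [SeqE.equivOne, Equiv.coe_fn_symm_mk, Sum.elim_inl, Sum.elim_inr, SeqE.N]
  rw [sum_SeqE_zero]
  cases k with
  | zero => simp [qBinom_zero_right]
  | succ k =>
    simp only [Nat.add_right_cancel_iff]
    rw [sum_SeqE_zero, qBinom_succ_succ, qBinom_zero, qBinom_zero]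
    cases k <;> simp

theorem sum_SeqE (k : ℕ) : ∀ n : ℕ,
    (∑ α : SeqE F n, if α.N = k then 1 else 0 : ℂ) = qBinom F n k
  | 0 => sum_SeqE_zero k
  | 1 => sum_SeqE_one k
  | n + 2 => by
    rw [sum_SeqE_add_two, sum_SeqE k (n + 1)]
    cases k with
    | zero => simp [qBinom_zero_right]
    | succ k =>
      simp only [Nat.add_right_cancel_iff]
      rw [sum_SeqE k (n + 1), sum_SeqE k n, qBinom_add_two]
termination_by n => (n, k)

theorem card_SeqE_N (n k : ℕ) : Nat.card {α : SeqE F n // α.N = k} = qBinom F n k := by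
  have := sum_SeqE (F := F) k n
  rw [Finset.sum_boole, ← Fintype.card_subtype, ← Nat.card_eq_fintype_card] at this
  exact_mod_cast this

theorem card_SeqE (n : ℕ) : Nat.card (SeqE F n) = galoisNumber F n := by
  rw [Nat.card_eq_fintype_card, ← Finset.card_univ, Finset.card_eq_sum_card_fiberwise
    (f := fun α : SeqE F n => α.N) (t := Finset.range (n + 1))]
  · refine Finset.sum_congr rfl fun k _ => ?_
    rw [← card_SeqE_N, Nat.card_eq_fintype_card, Fintype.card_subtype]
  · intro α _
    simpa [Nat.lt_succ_iff] using α.N_le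

end QCube

namespace QCube

open scoped Classical

variable {F : Type u} [Field F] {n : ℕ}

/-! ### The isotypic decomposition -/

/-- The projection of `ℂ[B_q(n+1)]` onto `ℂ[A_q(n+1)]`. -/
noncomputable def restrictA (F : Type u) [Field F] (n : ℕ) : CB F (n + 1) →ₗ[ℂ] CB F (n + 1) where
  toFun v Z := if Z ∈ Aq F n then v Z else 0
  map_add' u v := by ext Z; by_cases h : Z ∈ Aq F n <;> simp [h]
  map_smul' c v := by ext Z; by_cases h : Z ∈ Aq F n <;> simp [h]

theorem restrictA_apply (v : CB F (n + 1)) (Z : Bq F (n + 1)) :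
    restrictA F n v Z = if Z ∈ Aq F n then v Z else 0 := rfl

@[simp] theorem restrictA_up (v : CB F (n + 1)) (Y : Bq F n) : restrictA F n v (up Y) = 0 :=
  if_neg (up_notMem_Aq Y)

@[simp] theorem restrictA_aff (v : CB F (n + 1)) (Y : Bq F n) (a : Fin n → F) :
    restrictA F n v (aff Y a) = v (aff Y a) :=
  if_pos (aff_mem_Aq Y a)

variable [Fintype F]

/-- The maps need not be idempotent: p(χ) acts on W(χ) as q^n. -/
theorem iSupIndep_of_projections {ι V : Type*} [AddCommGroup V] [Module ℂ V]
    {S : ι → Submodule ℂ V} (P : ι → V →ₗ[ℂ] V) (h₁ : ∀ i, ∀ x ∈ S i, P i x = 0 → x = 0)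
    (h₂ : ∀ i j, j ≠ i → ∀ x ∈ S j, P i x = 0) : iSupIndep S := by
  rw [iSupIndep_def]
  intro i
  rw [Submodule.disjoint_def]
  intro x hx hx'
  have : ⨆ j, ⨆ (_ : j ≠ i), S j ≤ LinearMap.ker (P i) :=
    iSup₂_le fun j hj x hx => h₂ i j hj x hx
  exact h₁ i x hx (this hx')

theorem restrictA_embed (v : CB F n) : restrictA F n (embed F n v) = 0 :=
  CB_ext (fun Y => by simp) fun Y a => by simp

theorem restrictA_of_mem_W {χ : Char F n} {v : CB F (n + 1)} (hv : v ∈ W χ) :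
    restrictA F n v = v := by
  ext Z
  rw [restrictA_apply]
  split_ifs with h
  · rfl
  · exact (hv.1 Z h).symm

theorem p_of_mem_W {χ ψ : Char F n} {v : CB F (n + 1)} (hv : v ∈ W ψ) :
    p χ v = (if χ = ψ then (qq F : ℂ) ^ n else 0) • v := by
  ext Z
  rw [p_apply, Pi.smul_apply, ← sum_conj_addChar_mul, smul_eq_mul, Finset.sum_mul,
    ← Equiv.sum_comp (Equiv.neg (Fin n → F))]
  refine Finset.sum_congr rfl fun b _ => ?_
  rw [hv.2, conj_addChar, Pi.smul_apply, smul_eq_mul, ← addChar_apply]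
  simp [mul_assoc]

theorem p_restrictA_mem_W (χ : Char F n) (v : CB F (n + 1)) : p χ (restrictA F n v) ∈ W χ := by
  refine ⟨fun Z hZ => ?_, fun g => ?_⟩
  · obtain ⟨Y, rfl⟩ := exists_up_of_notMem_Aq hZ
    simp [p_apply, act_up]
  · obtain ⟨b, rfl⟩ := (hEquiv F n).surjective g
    refine CB_ext (fun Y => ?_) fun Y a => ?_
    · refine (act_up b.toAdd _ Y).trans ?_
      simp [p_apply, act_up]
    · refine (act_aff a b.toAdd _ Y).trans ?_
      rw [p_aff, Pi.smul_apply, p_aff, smul_eq_mul, Finset.mul_sum,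
        ← Equiv.sum_comp (Equiv.subRight b.toAdd)]
      refine Finset.sum_congr rfl fun c _ => ?_
      have h1 : addChar χ (-(c - b.toAdd)) = (χ (hEquiv F n b) : ℂ) * addChar χ (-c) := by
        rw [neg_sub, sub_eq_add_neg, AddChar.map_add_eq_mul]; rfl
      rw [Equiv.subRight_apply, h1, sub_sub_sub_cancel_right, mul_assoc]

/-- Dual orthogonality: the sum of χ(-b) over all χ vanishes unless b = 0. -/
theorem sum_p_restrictA (v : CB F (n + 1)) :
    ∑ χ : Char F n, p χ (restrictA F n v) = (qq F : ℂ) ^ n • restrictA F n v := by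
  refine CB_ext (fun Y => ?_) fun Y a => ?_
  · simp [p_apply, act_up]
  · rw [Finset.sum_apply, Pi.smul_apply]
    simp_rw [p_aff, restrictA_aff]
    rw [Finset.sum_comm]
    simp_rw [← Finset.sum_mul]
    have h : ∀ b : Fin n → F, ∑ χ : Char F n, addChar χ (-b) =
        if b = 0 then (qq F : ℂ) ^ n else 0 := by
      intro b
      rw [addChar_bijective.sum_comp fun ψ : AddChar (Fin n → F) ℂ => ψ (-b),
        AddChar.sum_apply_eq_ite]
      simp
    simp [h]

theorem iSupIndep_isotypic (F : Type u) [Field F] [Fintype F] (n : ℕ) :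
    iSupIndep fun i : Option (Char F n) => i.elim (LinearMap.range (embed F n)) W := by
  refine iSupIndep_of_projections
    (fun i => i.elim (LinearMap.id - restrictA F n) fun χ => p χ ∘ₗ restrictA F n) ?_ ?_
  · rintro (_ | χ) x hx h
    · obtain ⟨v, rfl⟩ := hx
      simpa [restrictA_embed] using h
    · have hx : x ∈ W χ := hx
      have h : p χ (restrictA F n x) = 0 := h
      rw [restrictA_of_mem_W hx, p_of_mem_W hx, if_pos rfl] at h
      exact (smul_eq_zero.1 h).resolve_left (pow_ne_zero _ qq_ne_zero)
  · rintro (_ | χ) (_ | ψ) hne x hx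
    · exact absurd rfl hne
    · have hx : x ∈ W ψ := hx
      simp [restrictA_of_mem_W hx]
    · obtain ⟨v, rfl⟩ := hx
      simp [restrictA_embed]
    · have hx : x ∈ W ψ := hx
      have hne : χ ≠ ψ := fun h => hne (by rw [h])
      simp [restrictA_of_mem_W hx, p_of_mem_W hx, hne]

theorem iSup_isotypic (F : Type u) [Field F] [Fintype F] (n : ℕ) :
    (⨆ i : Option (Char F n), i.elim (LinearMap.range (embed F n)) W) = ⊤ := by
  refine eq_top_iff.2 fun v _ => ?_
  have h1 : v - restrictA F n v = embed F n fun Y => v (up Y) :=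
    CB_ext (fun Y => by simp) fun Y a => by simp
  have h2 : restrictA F n v =
      ((qq F : ℂ) ^ n)⁻¹ • ∑ χ : Char F n, p χ (restrictA F n v) := by
    rw [sum_p_restrictA, inv_smul_smul₀ (pow_ne_zero _ qq_ne_zero)]
  rw [← sub_add_cancel v (restrictA F n v), h1]
  refine Submodule.add_mem _ (Submodule.mem_iSup_of_mem none ⟨_, rfl⟩) ?_
  rw [h2]
  exact Submodule.smul_mem _ _ (Submodule.sum_mem _ fun χ _ =>
    Submodule.mem_iSup_of_mem (some χ) (p_restrictA_mem_W χ v))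

/-! ### The vectors `v_α` -/

theorem SeqE.vec_zero (β : SeqE F n) :
    β.zero.vec = (qq F : ℂ) ^ β.N • embed F n β.vec + lam 1 β.vec := by
  rw [SeqE.vec, theta_eq_lam]

theorem SeqE.vec_one (β : SeqE F n) :
    β.one.vec = (qq F : ℂ) ^ (n - β.N) • embed F n β.vec + (-1 : ℂ) • lam 1 β.vec := by
  rw [SeqE.vec, theta_eq_lam, sub_eq_add_neg, neg_one_smul]

theorem SeqE.vec_char (β : SeqE F n) (χ : Char F (n + 1)) (hχ : χ ≠ 1) :
    (β.char χ hχ).vec = lam χ (push (tau (kernel χ)) β.vec) := by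
  rw [SeqE.vec, hyperplane_eq_kernel hχ, mu_eq_push]

theorem tau_kernel_injective {χ : Char F (n + 1)} (hχ : χ ≠ 1) :
    Function.Injective (tau (kernel χ)) :=
  tau_injective (Nat.add_right_cancel (dim_kernel hχ))

theorem range_tau_kernel {χ : Char F (n + 1)} (hχ : χ ≠ 1) :
    LinearMap.range (tau (kernel χ)) = kernel χ :=
  range_tau (Nat.add_right_cancel (dim_kernel hχ))

theorem isTrivialOn_of_push_ne_zero {χ : Char F (n + 1)} (hχ : χ ≠ 1) (v : CB F n)
    (X : Bq F (n + 1)) (hX : push (tau (kernel χ)) v X ≠ 0) : IsTrivialOn χ X := by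
  rw [isTrivialOn_iff_le_kernel, ← range_tau_kernel hχ]
  by_contra h
  exact hX (push_eq_zero v h)

/-- The earlier vector can be recovered: up to a power of q from the values at `up Y`, or, after a
character, from those at `aff Y 0` with Y in the hyperplane. -/
theorem SeqE.vec_ne_zero : ∀ {n : ℕ} (α : SeqE F n), α.vec ≠ 0
  | _, .nil => fun h => by simpa [SeqE.vec, ket_apply] using congrFun h ⊥
  | _, .zero β => fun h => β.vec_ne_zero <| funext fun Y => by
      simpa [SeqE.vec_zero] using congrFun h (up Y)
  | _, .one β => fun h => β.vec_ne_zero <| funext fun Y => by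
      simpa [SeqE.vec_one] using congrFun h (up Y)
  | _, .char β χ hχ => fun h => β.vec_ne_zero <| funext fun Y => by
      have hY : IsTrivialOn χ (Y.map (tau (kernel χ))) := isTrivialOn_iff_le_kernel.2
        ((LinearMap.map_le_range (f := tau (kernel χ))).trans (range_tau_kernel hχ).le)
      simpa [SeqE.vec_char, hY, push_map (tau_kernel_injective hχ)] using
        congrFun h (aff (Y.map (tau (kernel χ))) 0)

/-! ### Eigenvalues -/

theorem qNum_succ {F : Type u} [Fintype F] (m : ℕ) : (qNum F (m + 1) : ℂ) = qNum F m + (qq F : ℂ) ^ m := by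
  simp [qNum, Finset.sum_range_succ]

theorem qNum_succ' {F : Type u} [Fintype F] (m : ℕ) : (qNum F (m + 1) : ℂ) = qq F * qNum F m + 1 := by
  simp [qNum, Finset.sum_range_succ', Finset.mul_sum, pow_succ']

theorem SeqE.mulVec_vec : ∀ {n : ℕ} (α : SeqE F n),
    (Mq F n).mulVec α.vec = ((qNum F (n - α.N) : ℂ) - (qNum F α.N : ℂ)) • α.vec
  | _, .nil => by
    ext X
    have : ∀ Y : Bq F 0, dim Y = 0 := fun Y => Module.finrank_zero_of_subsingleton
    simp [Matrix.mulVec, dotProduct, Mq_apply, this, SeqE.N]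
  | _, .zero (n := n) β => by
    have hw : ∀ X, β.vec X ≠ 0 → IsTrivialOn 1 X := fun X _ => isTrivialOn_one X
    -- With n = N(β) + d the truncated differences disappear, and the coefficients of embed and lam
    -- 1 can be compared using both recursions for (m)_q.
    obtain ⟨d, hd⟩ := Nat.exists_eq_add_of_le β.N_le
    have hd' : n - β.N = d := by omega
    have hd'' : n + 1 - β.N = d + 1 := by omega
    have h1 := qNum_succ (F := F) d
    have h2 := qNum_succ' (F := F) d
    have h3 := qNum_succ (F := F) β.N
    have h4 := qNum_succ' (F := F) β.N
    have hn : (qq F : ℂ) ^ n = (qq F : ℂ) ^ β.N * (qq F : ℂ) ^ d := by rw [← pow_add, ← hd]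
    rw [SeqE.vec_zero, Matrix.mulVec_add, Matrix.mulVec_smul, mulVec_embed, mulVec_lam hw,
      β.mulVec_vec, if_pos rfl, SeqE.N, hd', hd'', hn]
    simp only [map_smul]
    match_scalars
    · linear_combination -(qq F : ℂ) ^ β.N * h1
    · linear_combination -h2 + h4 - h3
  | _, .one (n := n) β => by
    have hw : ∀ X, β.vec X ≠ 0 → IsTrivialOn 1 X := fun X _ => isTrivialOn_one X
    obtain ⟨d, hd⟩ := Nat.exists_eq_add_of_le β.N_le
    have hd' : n - β.N = d := by omega
    have hd'' : n + 1 - (β.N + 1) = d := by omega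
    have h1 := qNum_succ (F := F) d
    have h2 := qNum_succ' (F := F) d
    have h3 := qNum_succ (F := F) β.N
    have h4 := qNum_succ' (F := F) β.N
    have hn : (qq F : ℂ) ^ n = (qq F : ℂ) ^ β.N * (qq F : ℂ) ^ d := by rw [← pow_add, ← hd]
    rw [SeqE.vec_one, Matrix.mulVec_add, Matrix.mulVec_smul, Matrix.mulVec_smul, mulVec_embed,
      mulVec_lam hw, β.mulVec_vec, if_pos rfl, SeqE.N, hd', hd'', hn]
    simp only [map_smul]
    match_scalars
    · linear_combination (qq F : ℂ) ^ d * h3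
    · linear_combination h2 - h1 - h4
  | _, .char (n := n) β χ hχ => by
    have hd : n + 2 - (β.N + 1) = n - β.N + 1 := by
      have := β.N_le
      omega
    rw [SeqE.vec_char, mulVec_lam (isTrivialOn_of_push_ne_zero hχ _), if_neg hχ, zero_smul,
      add_zero, lam_mulVec_push (tau_kernel_injective hχ), β.mulVec_vec, map_smul, map_smul,
      smul_smul, SeqE.N, hd, qNum_succ', qNum_succ']
    -- The two summands 1 from `qNum_succ'` cancel in the difference, leaving q times the old
    -- eigenvalue.
    · congr 1
      ring
    · intro Y hY
      rw [range_tau_kernel hχ]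
      exact isTrivialOn_iff_le_kernel.1 hY

/-! ### Orthogonality and the basis property -/

theorem piInner_lam_embed (χ : Char F n) (u v : CB F n) :
    piInner (lam χ u) (embed F n v) = 0 := by
  rw [← piInner_conj, piInner_embed_lam, map_zero]

/-- The product separates into a form in the coefficients and the old inner product, so either
factor can supply the zero: the second for different β, the first for (β,0) against (β,1). -/
theorem piInner_combination (a b c d : ℂ) (u v : CB F n) :
    piInner (a • embed F n u + b • lam 1 u) (c • embed F n v + d • lam 1 v) =
      (starRingEnd ℂ a * c + (qq F : ℂ) ^ n * (starRingEnd ℂ b * d)) *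
        ((1 + (qq F : ℂ) ^ n)⁻¹ * piInner u v) := by
  have h1 : piInner (embed F n u) (embed F n v) = (1 + (qq F : ℂ) ^ n)⁻¹ * piInner u v :=
    piInner_push incl_injective u v
  have h2 := piInner_lam_lam (fun X (_ : u X ≠ 0) => isTrivialOn_one X) v
  simp only [piInner_add_left, piInner_add_right, piInner_smul_left, piInner_smul_right, h1, h2,
    piInner_embed_lam, piInner_lam_embed]
  ring

theorem SeqE.vec_zero' (β : SeqE F n) :
    β.zero.vec = (qq F : ℂ) ^ β.N • embed F n β.vec + (1 : ℂ) • lam 1 β.vec := by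
  rw [SeqE.vec_zero, one_smul]

theorem SeqE.piInner_zero_one (β : SeqE F n) : piInner β.zero.vec β.one.vec = 0 := by
  have hn : (qq F : ℂ) ^ β.N * (qq F : ℂ) ^ (n - β.N) = (qq F : ℂ) ^ n := by
    rw [← pow_add, Nat.add_sub_cancel' β.N_le]
  rw [SeqE.vec_zero', SeqE.vec_one, piInner_combination]
  simp [hn]

theorem piInner_combination_char {χ : Char F n} (hχ : χ ≠ 1) (a b : ℂ) (u v : CB F n) :
    piInner (a • embed F n u + b • lam 1 u) (lam χ v) = 0 := by
  rw [piInner_add_left, piInner_smul_left, piInner_smul_left, piInner_embed_lam,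
    piInner_lam_lam_of_ne hχ.symm]
  simp

theorem piInner_symm {u v : CB F n} (h : piInner u v = 0) : piInner v u = 0 := by
  rw [← piInner_conj, h, map_zero]

theorem SeqE.piInner_vec : ∀ {n : ℕ} (α β : SeqE F n), α ≠ β → piInner α.vec β.vec = 0
  | _, .nil, .nil, h => absurd rfl h
  | _, .zero α, .zero β, h => by
    rw [vec_zero', vec_zero', piInner_combination, α.piInner_vec β (fun e => h (by rw [e]))]
    simp
  | _, .one α, .one β, h => by
    rw [vec_one, vec_one, piInner_combination, α.piInner_vec β (fun e => h (by rw [e]))]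
    simp
  | _, .zero α, .one β, _ => by
    by_cases e : α = β
    · rw [e]
      exact β.piInner_zero_one
    · rw [vec_zero', vec_one, piInner_combination, α.piInner_vec β e]
      simp
  | _, .one α, .zero β, _ => by
    by_cases e : α = β
    · rw [e]
      exact piInner_symm β.piInner_zero_one
    · rw [vec_zero', vec_one, piInner_combination, α.piInner_vec β e]
      simp
  | _, .zero α, .char β χ hχ, _ => by
    rw [vec_zero', vec_char, piInner_combination_char hχ]
  | _, .one α, .char β χ hχ, _ => by
    rw [vec_one, vec_char, piInner_combination_char hχ]
  | _, .char β χ hχ, .zero α, _ => by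
    rw [vec_zero', vec_char, piInner_symm (piInner_combination_char hχ _ _ _ _)]
  | _, .char β χ hχ, .one α, _ => by
    rw [vec_one, vec_char, piInner_symm (piInner_combination_char hχ _ _ _ _)]
  | _, .char α χ hχ, .char β ψ hψ, h => by
    rw [vec_char, vec_char]
    by_cases e : χ = ψ
    · subst e
      rw [piInner_lam_lam (isTrivialOn_of_push_ne_zero hχ _), piInner_push (tau_kernel_injective hχ),
        α.piInner_vec β (fun e => h (by rw [e]))]
      simp
    · exact piInner_lam_lam_of_ne e _ _

theorem SeqE.linearIndependent_vec (F : Type u) [Field F] [Fintype F] (n : ℕ) :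
    LinearIndependent ℂ fun α : SeqE F n => α.vec := by
  rw [Fintype.linearIndependent_iff]
  intro c hc α
  let L : CB F n →ₗ[ℂ] ℂ :=
    { toFun := piInner α.vec
      map_add' := piInner_add_right _
      map_smul' := fun c v => piInner_smul_right c _ v }
  have h := congrArg L hc
  rw [map_sum, Finset.sum_eq_single α, map_smul, map_zero] at h
  · exact (smul_eq_zero.1 h).resolve_right (piInner_self_ne_zero α.vec_ne_zero)
  · intro β _ hβ
    rw [map_smul]
    exact (congrArg _ (α.piInner_vec β hβ.symm)).trans (smul_zero _)
  · simp

/-- The number of independent vectors equals the dimension, both being the Galois number. -/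
theorem SeqE.span_vec (F : Type u) [Field F] [Fintype F] (n : ℕ) :
    Submodule.span ℂ (Set.range fun α : SeqE F n => α.vec) = ⊤ := by
  refine (linearIndependent_vec F n).span_eq_top_of_card_eq_finrank' ?_
  rw [Module.finrank_fintype_fun_eq_card, card_Bq, ← card_SeqE, Nat.card_eq_fintype_card]

end QCube

theorem theorem2 (F : Type*) [Field F] [Fintype F] (n : ℕ) :
    -- the index set and its subsets of sequences with `k` nonzero entries have the right sizes
    (∀ α : QCube.SeqE F n, α.N ≤ n) ∧
    Nat.card (QCube.SeqE F n) = QCube.galoisNumber F n ∧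
    (∀ k : ℕ, Nat.card {α : QCube.SeqE F n // α.N = k} = QCube.qBinom F n k) ∧
    -- no choices: the hyperplane `X(χ)` and the Schubert normal form are uniquely determined
    (∀ χ : QCube.Char F n, χ ≠ 1 → ∃! X : QCube.Bq F n, QCube.IsHyperplaneOf χ X) ∧
    (∀ X : QCube.Bq F n, ∃! M : Matrix (Fin n) (Fin (QCube.dim X)) F,
      QCube.IsSchubertFormOf X M) ∧
    -- the decomposition of `ℂ[B_q(n+1)]` and the position of the vectors in it
    iSupIndep (fun i : Option (QCube.Char F n) =>
      i.elim (LinearMap.range (QCube.embed F n)) QCube.W) ∧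
    (⨆ i : Option (QCube.Char F n),
      i.elim (LinearMap.range (QCube.embed F n)) QCube.W) = ⊤ ∧
    (∀ β : QCube.SeqE F n,
      β.zero.vec ∈ LinearMap.range (QCube.embed F n) ⊔ QCube.W (1 : QCube.Char F n) ∧
      β.one.vec ∈ LinearMap.range (QCube.embed F n) ⊔ QCube.W (1 : QCube.Char F n)) ∧
    (∀ (β : QCube.SeqE F n) (χ : QCube.Char F (n + 1)) (hχ : χ ≠ 1),
      (β.char χ hχ).vec ∈ QCube.W χ) ∧
    -- the vectors are eigenvectors
    (∀ α : QCube.SeqE F n,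
      (QCube.Mq F n).mulVec α.vec =
        ((QCube.qNum F (n - α.N) : ℂ) - (QCube.qNum F α.N : ℂ)) • α.vec) ∧
    -- they form a basis
    LinearIndependent ℂ (fun α : QCube.SeqE F n => α.vec) ∧
    Submodule.span ℂ (Set.range fun α : QCube.SeqE F n => α.vec) = ⊤ ∧
    -- which is orthogonal
    (∀ α β : QCube.SeqE F n, α ≠ β → QCube.piInner α.vec β.vec = 0) := by
  refine ⟨fun α => α.N_le, QCube.card_SeqE n, QCube.card_SeqE_N n, ?_, ?_,
    QCube.iSupIndep_isotypic F n, QCube.iSup_isotypic F n, fun β => ⟨?_, ?_⟩, ?_,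
    fun α => α.mulVec_vec, QCube.SeqE.linearIndependent_vec F n, QCube.SeqE.span_vec F n,
    fun α β => α.piInner_vec β⟩
  · exact fun χ hχ => ⟨QCube.kernel χ, (QCube.isHyperplaneOf_iff hχ).2 rfl,
      fun X hX => (QCube.isHyperplaneOf_iff hχ).1 hX⟩
  · exact fun X => ⟨_, QCube.schubertForm_spec rfl,
      fun M hM => hM.unique (QCube.schubertForm_spec rfl)⟩
  · rw [QCube.SeqE.vec_zero]
    exact Submodule.add_mem_sup (Submodule.smul_mem _ _ ⟨_, rfl⟩) (QCube.lam_mem_W 1 _)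
  · rw [QCube.SeqE.vec_one]
    exact Submodule.add_mem_sup (Submodule.smul_mem _ _ ⟨_, rfl⟩)
      (Submodule.smul_mem _ _ (QCube.lam_mem_W 1 _))
  · intro β χ hχ
    exact QCube.lam_mem_W χ _
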